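/- For $0\le s\le m$ let $\mathbb{R}^m_s$ be $\mathbb{R}^m$ with the pseudo-inner product $\langle u,v\rangle_s=-\sum_{i\le s}u_iv_i+\sum_{i>s}u_iv_i$, and let $S^5_2=\{p\in\mathbb{R}^6_2 : \langle p,p\rangle_2=1\}$ with the induced metric. Let $N$ be $\mathbb{R}^5_2$ or $S^5_2$, with Levi-Civita connection $\bar\nabla$. Let $M$ be a smooth connected non-degenerate (immersed) hypersurface of $N$, of dimension $4$, with a smooth unit normal vector field $\xi$ (so $\langle\xi,\xi\rangle$ is constantly $1$ or constantly $-1$), with induced metric $\langle\cdot,\cdot\rangle$ and with shape operator $AX=-\bar\nabla_X\xi$. The hypersurface $M$ is called isoparametric if its principal curvatures (the complex eigenvalues of $A$, with algebraic multiplicity) are constant on $M$. It is said to have Petrov type IV of index $2$ if, at each $x\in M$, there are a basis of $T_xM$ and real numbers $\alpha,\beta,b,\varepsilon$ with $\beta>0$ and $\varepsilon\in\{1,-1\}$ such that the matrices of $A_x$ and of $\langle\cdot,\cdot\rangle_x$ with respect to this basis are $$\begin{pmatrix}\alpha&-\beta&0&0\\ \beta&\alpha&0&0\\ 0&0&b&1\\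 0&0&0&b\end{pmatrix}\quad\text{and}\quad\begin{pmatrix}-1&0&0&0\\ 0&1&0&0\\ 0&0&0&\varepsilon\\ 0&0&\varepsilon&0\end{pmatrix}.$$ **Theorem 4.20.** There exist no isoparametric hypersurfaces whose Petrov type is type IV of index $2$ in $\mathbb{R}^5_2$ or $S^5_2$. -/

import Mathlib

open scoped Manifold ContDiff

noncomputable section

/-- The pseudo-inner product `⟨u, v⟩_s = -∑_{i < s} u_i v_i + ∑_{i ≥ s} u_i v_i` of the
pseudo-Euclidean space `ℝ^m_s`. The Euclidean norm of `EuclideanSpace ℝ (Fin m)` is used only for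
the topology and the smooth structure. -/
def pseudoInner (m s : ℕ) : LinearMap.BilinForm ℝ (EuclideanSpace ℝ (Fin m)) :=
  LinearMap.mk₂ ℝ (fun u v => ∑ i : Fin m, (if (i : ℕ) < s then -1 else 1) * (u i * v i))
    (fun u u' v => by
      simp only [PiLp.add_apply, add_mul, mul_add, Finset.sum_add_distrib])
    (fun c u v => by
      simp only [PiLp.smul_apply, smul_eq_mul, Finset.mul_sum]
      exact Finset.sum_congr rfl fun i _ => by ring)
    (fun u v v' => by
      simp only [PiLp.add_apply, mul_add, Finset.sum_add_distrib])
    (fun c u v => by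
      simp only [PiLp.smul_apply, smul_eq_mul, Finset.mul_sum]
      exact Finset.sum_congr rfl fun i _ => by ring)

theorem pseudoInner_symm (m s : ℕ) (u v : EuclideanSpace ℝ (Fin m)) :
    pseudoInner m s u v = pseudoInner m s v u := by
  simp only [pseudoInner, LinearMap.mk₂_apply]
  exact Finset.sum_congr rfl fun i _ => by ring

/-- If `⟨f, f⟩` is constant, then `⟨f, df⟩ = 0`. -/
theorem form_mfderiv_eq_zero {m : ℕ} {B : LinearMap.BilinForm ℝ (EuclideanSpace ℝ (Fin m))}
    (hB : ∀ u v, B u v = B v u) {E H M : Type*} [NormedAddCommGroup E] [NormedSpace ℝ E]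
    [TopologicalSpace H] {I : ModelWithCorners ℝ E H} [TopologicalSpace M] [ChartedSpace H M]
    {f : M → EuclideanSpace ℝ (Fin m)} {x : M}
    (hf : MDifferentiableAt I 𝓘(ℝ, EuclideanSpace ℝ (Fin m)) f x) {c : ℝ}
    (hc : ∀ y, B (f y) (f y) = c) (v : TangentSpace I x) :
    B (f x) (mfderiv I 𝓘(ℝ, EuclideanSpace ℝ (Fin m)) f x v) = 0 := by
  let B' := B.toContinuousBilinearMap
  have hq : HasFDerivAt (fun p => B' p p) (B' (f x) + B'.flip (f x)) (f x) := by
    have h := B'.hasFDerivAt_of_bilinear (hasFDerivAt_id (f x)) (hasFDerivAt_id (f x))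
    refine h.congr_fderiv ?_
    ext w
    simp
  have h1 := hq.hasMFDerivAt.comp x hf.hasMFDerivAt
  have h2 : ((fun p => B' p p) ∘ f) = fun _ => c := funext hc
  rw [h2] at h1
  have h3 := hasMFDerivAt_unique h1 (hasMFDerivAt_const c x)
  have h4 := DFunLike.congr_fun h3 v
  have h5 : B (f x) (mfderiv I 𝓘(ℝ, EuclideanSpace ℝ (Fin m)) f x v) +
      B (mfderiv I 𝓘(ℝ, EuclideanSpace ℝ (Fin m)) f x v) (f x) = 0 := h4
  rw [hB (mfderiv I 𝓘(ℝ, EuclideanSpace ℝ (Fin m)) f x v)] at h5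
  linarith

instance {n : ℕ} {M : Type*} [TopologicalSpace M] [ChartedSpace (EuclideanSpace ℝ (Fin n)) M]
    (x : M) : Module.Finite ℝ (TangentSpace (𝓡 n) x) :=
  inferInstanceAs (Module.Finite ℝ (EuclideanSpace ℝ (Fin n)))

/-- The `d`-dimensional pseudo-Riemannian space forms of curvature `0` and `1` and index `s`
(`s < d` for the pseudo-sphere). -/
inductive SpaceForm (d : ℕ) where
  | pseudoEuclidean (s : ℕ) : SpaceForm d
  | pseudoSphere (s : ℕ) : SpaceForm d

namespace SpaceForm

variable {d : ℕ}

/-- The dimension of the pseudo-Euclidean space which contains the space form: `ℝ^d_s` is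
contained in itself, and `S^d_s` in `ℝ^{d+1}_s`. -/
abbrev vecDim : SpaceForm d → ℕ
  | pseudoEuclidean _ => d
  | pseudoSphere _ => d + 1

/-- The index `s`. -/
abbrev index : SpaceForm d → ℕ
  | pseudoEuclidean s => s
  | pseudoSphere s => s

/-- The constant curvature `κ`. -/
def curvature : SpaceForm d → ℝ
  | pseudoEuclidean _ => 0
  | pseudoSphere _ => 1

/-- The pseudo-Euclidean vector space containing the space form. -/
abbrev Vec (N : SpaceForm d) : Type := EuclideanSpace ℝ (Fin N.vecDim)

/-- The pseudo-inner product of the pseudo-Euclidean vector space containing the space form. -/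
def form (N : SpaceForm d) : LinearMap.BilinForm ℝ N.Vec := pseudoInner N.vecDim N.index

/-- The points of the space form: all of `ℝ^d_s`, and
`S^d_s = {p ∈ ℝ^{d+1}_s | ⟨p, p⟩_s = 1}`. -/
def carrier : (N : SpaceForm d) → Set N.Vec
  | pseudoEuclidean _ => Set.univ
  | pseudoSphere s => {p | (pseudoSphere s : SpaceForm d).form p p = 1}

/-- The tangent space of the space form at `p`, a subspace of the containing vector space:
everything for `ℝ^d_s`, and the orthogonal complement of `p` for `S^d_s`. -/
def tangent : (N : SpaceForm d) → (p : N.Vec) → Submodule ℝ N.Vec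
  | pseudoEuclidean _, _ => ⊤
  | pseudoSphere s, p => LinearMap.ker ((pseudoSphere s : SpaceForm d).form p)

/-- The orthogonal projection `w ↦ w - κ ⟨p, w⟩ p` of the containing vector space onto the tangent
space of the space form at its point `p`. -/
def tangentProj (N : SpaceForm d) (p : N.Vec) : N.Vec →ₗ[ℝ] N.Vec :=
  LinearMap.id - N.curvature • (N.form p).smulRight p

end SpaceForm

/-- A (connected, non-degenerate, immersed) hypersurface of the space form `N`, with a unit normal
vector field. Here `M` is an `n`-manifold; it is assumed to be smooth and connected where
hypersurfaces are used. An embedded hypersurface is the case in which `toFun` is an inclusion. -/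
structure Hypersurface {n : ℕ} (N : SpaceForm (n + 1)) (M : Type*) [TopologicalSpace M]
    [ChartedSpace (EuclideanSpace ℝ (Fin n)) M] where
  /-- the immersion `ι : M → N`, as a map into the containing vector space -/
  toFun : M → N.Vec
  contMDiff_toFun : ContMDiff (𝓡 n) 𝓘(ℝ, N.Vec) ∞ toFun
  mem_carrier : ∀ x, toFun x ∈ N.carrier
  injective_mfderiv : ∀ x, Function.Injective (mfderiv (𝓡 n) 𝓘(ℝ, N.Vec) toFun x)
  /-- the induced metric is non-degenerate -/
  nondegenerate : ∀ (x : M) (v : TangentSpace (𝓡 n) x),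
    (∀ w : TangentSpace (𝓡 n) x, N.form (mfderiv (𝓡 n) 𝓘(ℝ, N.Vec) toFun x v)
      (mfderiv (𝓡 n) 𝓘(ℝ, N.Vec) toFun x w) = 0) → v = 0
  /-- the unit normal vector field `ξ` -/
  normal : M → N.Vec
  contMDiff_normal : ContMDiff (𝓡 n) 𝓘(ℝ, N.Vec) ∞ normal
  normal_mem_tangent : ∀ x, normal x ∈ N.tangent (toFun x)
  normal_orthogonal : ∀ (x : M) (v : TangentSpace (𝓡 n) x),
    N.form (mfderiv (𝓡 n) 𝓘(ℝ, N.Vec) toFun x v) (normal x) = 0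
  /-- the number `ν = ⟨ξ, ξ⟩` -/
  sign : ℝ
  sign_eq : sign = 1 ∨ sign = -1
  normal_normal : ∀ x, N.form (normal x) (normal x) = sign

namespace Hypersurface

variable {n : ℕ} {N : SpaceForm (n + 1)} {M : Type*} [TopologicalSpace M]
  [ChartedSpace (EuclideanSpace ℝ (Fin n)) M] (H : Hypersurface N M)

/-- The differential `T_x M → T_{ι x} N` of the immersion. -/
def differential (x : M) : TangentSpace (𝓡 n) x →ₗ[ℝ] N.Vec :=
  (mfderiv (𝓡 n) 𝓘(ℝ, N.Vec) H.toFun x).toLinearMap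

/-- The differential `D ξ` of the normal field as a map into the containing vector space. -/
def normalDifferential (x : M) : TangentSpace (𝓡 n) x →ₗ[ℝ] N.Vec :=
  (mfderiv (𝓡 n) 𝓘(ℝ, N.Vec) H.normal x).toLinearMap

/-- The induced metric `⟨v, w⟩` on `T_x M`. -/
def metric (x : M) : LinearMap.BilinForm ℝ (TangentSpace (𝓡 n) x) :=
  N.form.compl₁₂ (H.differential x) (H.differential x)

/-- The covariant derivative `v ↦ ∇̄_v ξ` for the Levi-Civita connection of `N`, which is the
tangential part of the derivative in the containing vector space. -/
def covDerivNormal (x : M) : TangentSpace (𝓡 n) x →ₗ[ℝ] N.Vec :=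
  N.tangentProj (H.toFun x) ∘ₗ H.normalDifferential x

/-- The shape operator `A_x v = -∇̄_v ξ`, where `T_x M` is identified with its image in `T_{ι x} N`;
see `differential_shapeOperator`. -/
def shapeOperator (x : M) : TangentSpace (𝓡 n) x →ₗ[ℝ] TangentSpace (𝓡 n) x :=
  (H.differential x).leftInverse ∘ₗ (-H.covDerivNormal x)

theorem differential_apply_mem_tangent (x : M) (v : TangentSpace (𝓡 n) x) :
    H.differential x v ∈ N.tangent (H.toFun x) := by
  cases N with
  | pseudoEuclidean s => exact Submodule.mem_top
  | pseudoSphere s =>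
    have h := form_mfderiv_eq_zero (I := 𝓡 n) (pseudoInner_symm _ _)
      (H.contMDiff_toFun.mdifferentiable (by simp) x) (fun y => H.mem_carrier y) v
    exact LinearMap.mem_ker.2 h

theorem covDerivNormal_mem_tangent (x : M) (v : TangentSpace (𝓡 n) x) :
    H.covDerivNormal x v ∈ N.tangent (H.toFun x) := by
  cases N with
  | pseudoEuclidean s => exact Submodule.mem_top
  | pseudoSphere s =>
    have h : (SpaceForm.pseudoSphere s : SpaceForm (n + 1)).form (H.toFun x) (H.toFun x) = 1 :=
      H.mem_carrier x
    refine LinearMap.mem_ker.2 ?_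
    simp [covDerivNormal, SpaceForm.tangentProj, SpaceForm.curvature, h]

theorem form_covDerivNormal_normal (x : M) (v : TangentSpace (𝓡 n) x) :
    N.form (H.normal x) (H.covDerivNormal x v) = 0 := by
  have h := form_mfderiv_eq_zero (I := 𝓡 n) (pseudoInner_symm _ _)
    (H.contMDiff_normal.mdifferentiable (by simp) x) (fun y => H.normal_normal y) v
  change N.form (H.normal x) (H.normalDifferential x v) = 0 at h
  have ht := H.normal_mem_tangent x
  cases N with
  | pseudoEuclidean s =>
    simpa [covDerivNormal, SpaceForm.tangentProj, SpaceForm.curvature] using h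
  | pseudoSphere s =>
    have ht' := LinearMap.mem_ker.1 ht
    have ht'' : (SpaceForm.pseudoSphere s : SpaceForm (n + 1)).form (H.normal x) (H.toFun x) = 0 :=
      (pseudoInner_symm _ _ _ _).trans ht'
    simp [covDerivNormal, SpaceForm.tangentProj, SpaceForm.curvature, h, ht'']

theorem finrank_le (x : M) :
    Module.finrank ℝ ↥(N.tangent (H.toFun x) ⊓ LinearMap.ker (N.form (H.normal x))) ≤ n := by
  have hs : H.sign ≠ 0 := by rcases H.sign_eq with h | h <;> rw [h] <;> norm_num
  have hξ := H.normal_normal x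
  have ht := H.normal_mem_tangent x
  set K := LinearMap.ker ((N.form (H.normal x)).domRestrict (N.tangent (H.toFun x))) with hK
  have h1 : Module.finrank ℝ ↥K + 1 = Module.finrank ℝ ↥(N.tangent (H.toFun x)) := by
    refine Module.Dual.finrank_ker_add_one_of_ne_zero fun h => hs ?_
    rw [← hξ]
    exact LinearMap.congr_fun h ⟨_, ht⟩
  have h2 : N.tangent (H.toFun x) ⊓ LinearMap.ker (N.form (H.normal x)) =
      K.map (N.tangent (H.toFun x)).subtype := by
    ext w
    simp [hK, Submodule.mem_map, and_comm]
  have h3 : Module.finrank ℝ ↥(N.tangent (H.toFun x)) = n + 1 := by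
    have hm := H.mem_carrier x
    clear_value K
    clear h1 h2 hK ht hξ K
    cases N with
    | pseudoEuclidean s =>
      exact (finrank_top ℝ _).trans finrank_euclideanSpace_fin
    | pseudoSphere s =>
      have h4 : Module.finrank ℝ ↥(LinearMap.ker
          ((SpaceForm.pseudoSphere s : SpaceForm (n + 1)).form (H.toFun x))) + 1 =
          Module.finrank ℝ (SpaceForm.pseudoSphere s : SpaceForm (n + 1)).Vec := by
        refine Module.Dual.finrank_ker_add_one_of_ne_zero fun h => ?_
        have hm' : (SpaceForm.pseudoSphere s : SpaceForm (n + 1)).form (H.toFun x) (H.toFun x) = 1 :=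
          hm
        rw [h] at hm'
        simp at hm'
      have h5 : Module.finrank ℝ (SpaceForm.pseudoSphere s : SpaceForm (n + 1)).Vec = n + 2 :=
        finrank_euclideanSpace_fin
      change Module.finrank ℝ ↥(LinearMap.ker
          ((SpaceForm.pseudoSphere s : SpaceForm (n + 1)).form (H.toFun x))) = n + 1
      omega
  rw [h2, Submodule.finrank_map_subtype_eq]
  omega

/-- The defining equation `dι (A_x v) = -∇̄_v ξ` of the shape operator. -/
theorem differential_shapeOperator (x : M) (v : TangentSpace (𝓡 n) x) :
    H.differential x (H.shapeOperator x v) = -H.covDerivNormal x v := by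
  have hinj : Function.Injective (H.differential x) := H.injective_mfderiv x
  have hle : LinearMap.range (H.differential x) ≤
      N.tangent (H.toFun x) ⊓ LinearMap.ker (N.form (H.normal x)) := by
    rintro _ ⟨w, rfl⟩
    exact ⟨H.differential_apply_mem_tangent x w, LinearMap.mem_ker.2
      ((pseudoInner_symm _ _ _ _).trans (H.normal_orthogonal x w))⟩
  have heq := Submodule.eq_of_le_of_finrank_le hle (by
    rw [LinearMap.finrank_range_of_inj hinj]
    exact (H.finrank_le x).trans_eq (finrank_euclideanSpace_fin (𝕜 := ℝ) (n := n)).symm)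
  have hmem : -H.covDerivNormal x v ∈ LinearMap.range (H.differential x) := by
    rw [heq]
    exact neg_mem ⟨H.covDerivNormal_mem_tangent x v,
      LinearMap.mem_ker.2 (H.form_covDerivNormal_normal x v)⟩
  obtain ⟨w, hw⟩ := hmem
  have hA : H.shapeOperator x v = (H.differential x).leftInverse (-H.covDerivNormal x v) := rfl
  rw [hA, ← hw, LinearMap.leftInverse_apply_of_inj (LinearMap.ker_eq_bot.2 hinj)]

/-- The principal curvatures at `x`: the eigenvalues of the complexified shape operator, counted
with algebraic multiplicity. -/
def principalCurvatures (x : M) : Multiset ℂ := (H.shapeOperator x).charpoly.aroots ℂ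

/-- `M` is isoparametric: its principal curvatures are constant. -/
def IsIsoparametric : Prop := ∀ x y : M, H.principalCurvatures x = H.principalCurvatures y

end Hypersurface

/-- The pair of an endomorphism `A` and a symmetric bilinear form `g` on a 4-dimensional real vector
space has Petrov type IV of index 2: one pair `α ± iβ` of complex eigenvalues and a real `2 × 2`
Jordan block. -/
def IsPetrovTypeIV {V : Type*} [AddCommGroup V] [Module ℝ V] (A : V →ₗ[ℝ] V)
    (g : LinearMap.BilinForm ℝ V) : Prop :=
  ∃ (e : Module.Basis (Fin 4) ℝ V) (α β b ε : ℝ), 0 < β ∧ (ε = 1 ∨ ε = -1) ∧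
    LinearMap.toMatrix e e A =
      !![α, -β, 0, 0;
         β,  α, 0, 0;
         0,  0, b, 1;
         0,  0, 0, b] ∧
    LinearMap.BilinForm.toMatrix e g =
      !![-1, 0, 0, 0;
          0, 1, 0, 0;
          0, 0, 0, ε;
          0, 0, ε, 0]

/-- The Petrov type of the hypersurface is type IV of index 2: this is the type of the shape operator
and the induced metric at each point. -/
def Hypersurface.HasPetrovTypeIV {N : SpaceForm 5} {M : Type*} [TopologicalSpace M]
    [ChartedSpace (EuclideanSpace ℝ (Fin 4)) M] (H : Hypersurface N M) : Prop :=
  ∀ x : M, IsPetrovTypeIV (H.shapeOperator x) (H.metric x)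

end

/-! The induced metric already has index 2, so the unit normal has square +1. The principal
curvatures are λ = α + iβ, its conjugate, and b twice. Over ℂ the value λ is a simple eigenvalue
whose eigenvectors are non-null, so locally there is a smooth complex eigenvector field Z with ⟨Z,Z⟩
= 1, and Cartan's argument applies to it.

Write κ for the curvature of the ambient space and T = ∇Z, and let E be the spectral projection onto
Z. The Codazzi equation gives ∇_Z Z = 0 (`vD_ζ`) and the derivative of A along Z (`deriv_A`); the
Gauss equation gives the Riccati equation for T (`deriv_T`). Let L invert A - λ off the eigenline.
As all tr A^k are constant, tr(LT) = 0, and differentiating this along Z leaves tr(LQ) = 0 for the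
curvature term Q = λA + κ - (κ + λ²)E (`Matrix.trace_eq_zero_of_riccati`). This is Cartan's identity
(|λ|² + κ)/(conj λ - λ) + 2(λb + κ)/(b - λ) = 0.

The nilpotent part of the Jordan block does not enter the trace. With s = |λ|² + κ > 0, the real
part of the cleared equation forces αb ≥ 0 and the imaginary part forces s + 4(αb + κ) = 0, which is
absurd (`false_of_cartan`). -/

noncomputable section

/-! ### Trace identities for a derivation of a matrix algebra -/

namespace Matrix

variable {R n : Type*} [CommRing R] [Algebra ℂ R] [Fintype n]

/-- The derivation `X ↦ D X - [N, X]` of the matrix algebra. -/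
def twistedDeriv (D : Derivation ℂ R R) (N X : Matrix n n R) : Matrix n n R :=
  X.map D - (N * X - X * N)

theorem map_derivation_mul (D : Derivation ℂ R R) (X Y : Matrix n n R) :
    (X * Y).map D = X.map D * Y + X * Y.map D := by
  ext i j
  simp [Matrix.mul_apply, Finset.sum_add_distrib.symm, add_comm, mul_comm]

theorem twistedDeriv_mul (D : Derivation ℂ R R) (N X Y : Matrix n n R) :
    twistedDeriv D N (X * Y) = twistedDeriv D N X * Y + X * twistedDeriv D N Y := by
  simp only [twistedDeriv, map_derivation_mul]
  noncomm_ring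

/-- Commutators have trace zero. -/
theorem trace_twistedDeriv (D : Derivation ℂ R R) (N X : Matrix n n R) :
    (twistedDeriv D N X).trace = D X.trace := by
  have : (X.map D).trace = D X.trace := by simp [Matrix.trace]
  rw [twistedDeriv, Matrix.trace_sub, Matrix.trace_sub, Matrix.trace_mul_comm N X, this]
  simp

variable [DecidableEq n]

theorem twistedDeriv_one (D : Derivation ℂ R R) (N : Matrix n n R) : twistedDeriv D N 1 = 0 := by
  have h := twistedDeriv_mul D N 1 1
  simpa using h

theorem twistedDeriv_sub (D : Derivation ℂ R R) (N X Y : Matrix n n R) :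
    twistedDeriv D N (X - Y) = twistedDeriv D N X - twistedDeriv D N Y := by
  have : (X - Y).map D = X.map D - Y.map D := by ext; simp
  simp only [twistedDeriv, this]
  noncomm_ring

theorem twistedDeriv_algebraMap (D : Derivation ℂ R R) (N : Matrix n n R) (c : ℂ) :
    twistedDeriv D N (algebraMap ℂ (Matrix n n R) c) = 0 := by
  have : (algebraMap ℂ (Matrix n n R) c).map D = 0 := by
    ext i j
    by_cases h : i = j <;> simp [Matrix.algebraMap_matrix_apply, h]
  simp [twistedDeriv, this, Algebra.commutes]

theorem trace_twistedDeriv_pow (D : Derivation ℂ R R) (N A : Matrix n n R) (k : ℕ) :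
    (twistedDeriv D N (A ^ (k + 1))).trace = (k + 1) * (A ^ k * twistedDeriv D N A).trace := by
  -- The extra factor B, commuting with A, makes the induction close: the last factor of A^(k+1) is
  -- absorbed into B.
  have key : ∀ (k : ℕ) (B : Matrix n n R), Commute A B →
      (twistedDeriv D N (A ^ (k + 1)) * B).trace =
        (k + 1) * (A ^ k * B * twistedDeriv D N A).trace := by
    intro k
    induction k with
    | zero =>
      intro B _
      simp [Matrix.trace_mul_comm B]
    | succ k ih =>
      intro B hB
      have h1 : (A ^ (k + 1) * twistedDeriv D N A * B).trace =
          (A ^ (k + 1) * B * twistedDeriv D N A).trace := by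
        rw [Matrix.trace_mul_comm, ← mul_assoc, (hB.pow_left (k + 1)).eq]
      rw [pow_succ A (k + 1), twistedDeriv_mul, add_mul, Matrix.trace_add, mul_assoc,
        ih (A * B) ((Commute.refl A).mul_right hB), ← mul_assoc (A ^ k), ← pow_succ, h1]
      push_cast
      ring
  simpa using key k 1 (Commute.one_right A)

/-- By linearity it is enough to treat powers of A, where the trace is, up to the invertible
constant k + 1, the derivative of tr A^(k+1). -/
theorem trace_aeval_mul_twistedDeriv (D : Derivation ℂ R R) (N A : Matrix n n R)
    (hA : ∀ k : ℕ, D (A ^ k).trace = 0) (p : Polynomial ℂ) :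
    (Polynomial.aeval A p * twistedDeriv D N A).trace = 0 := by
  induction p using Polynomial.induction_on' with
  | add p q hp hq => simp [add_mul, hp, hq]
  | monomial k c =>
    have h := trace_twistedDeriv_pow D N A k
    rw [trace_twistedDeriv, hA] at h
    have hk : IsUnit ((k : R) + 1) := by
      have : IsUnit ((k : ℂ) + 1) := (Nat.cast_add_one_ne_zero k).isUnit
      simpa using this.map (algebraMap ℂ R)
    have h' := (hk.mul_right_eq_zero).1 h.symm
    rw [Polynomial.aeval_monomial, mul_assoc, Algebra.algebraMap_eq_smul_one, smul_mul_assoc,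
      one_mul, Matrix.trace_smul, h', smul_zero]

/-- The trace identity which follows from the Riccati equation of the shape operator along a line
of curvature with constant principal curvature `c`. -/
theorem trace_eq_zero_of_riccati (D : Derivation ℂ R R) (N A T E Q : Matrix n n R) (c : ℂ)
    (e l : Polynomial ℂ) (hE : E = Polynomial.aeval A e) (hEE : E * E = E)
    (hl : l * (Polynomial.X - Polynomial.C c) = 1 - e)
    (hTE : T * E = 0) (hET : E * T = 0)
    (hA : twistedDeriv D N A = -(T * (A - algebraMap ℂ _ c)))
    (hT : twistedDeriv D N T = -(T * T) - Q)
    (htr : ∀ k : ℕ, D (A ^ k).trace = 0) :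
    (Polynomial.aeval A l * Q).trace = 0 := by
  set L := Polynomial.aeval A l with hL
  set S := A - algebraMap ℂ (Matrix n n R) c with hS
  have hLS : L * S = 1 - E := by
    have := congrArg (Polynomial.aeval A) hl
    simpa [hL, hS, hE] using this
  have hSL : S * L = 1 - E := by
    have := congrArg (Polynomial.aeval A) ((mul_comm _ _).trans hl)
    simpa [hL, hS, hE] using this
  have hLE : L * E = E * L := by
    rw [hL, hE, ← map_mul, ← map_mul, mul_comm]
  -- T = TSL because TE = 0; by cyclicity the trace is tr(L²·TS), and TS is minus the derivative of
  -- A.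
  have h1 : (L * T).trace = 0 := by
    have hT' : T = T * S * L := by rw [mul_assoc, hSL, mul_sub, hTE]; simp
    have h2 := trace_aeval_mul_twistedDeriv D N A htr (l * l)
    rw [hA, map_mul, ← hL] at h2
    calc (L * T).trace = (L * (T * S * L)).trace := by rw [← hT']
      _ = (L * L * (T * S)).trace := by
        rw [← mul_assoc, Matrix.trace_mul_comm, ← mul_assoc]
      _ = 0 := by simpa using h2
  set dL := twistedDeriv D N L with hdL
  set dE := twistedDeriv D N E with hdE
  have h3 : -(T * S) * L + S * dL = -dE := by
    have h := congrArg (twistedDeriv D N) hSL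
    rw [twistedDeriv_mul, hS, twistedDeriv_sub,
      twistedDeriv_algebraMap, sub_zero, hA, ← hS, twistedDeriv_sub, twistedDeriv_one, ← hdL, ← hdE] at h
    simpa using h
  have h4 : (1 - E) * dL = L * T - L * dE := by
    have h := congrArg (L * ·) h3
    simp only [mul_add] at h
    rw [← mul_assoc L S, hLS, neg_mul, mul_assoc T, hSL, mul_sub, hTE] at h
    simp only [mul_one, sub_zero, mul_neg] at h
    rw [← sub_eq_zero] at h ⊢
    rw [← h]
    abel
  have hdEE : dE * E + E * dE = dE := by
    rw [hdE, ← twistedDeriv_mul, hEE]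
  -- Since TE = 0, only (1 - E)dL contributes, and `h4` expresses it. The term with dE drops out: dE
  -- = dE·E + E·dE, and E annihilates TL from both sides.
  have h5 : (dL * T).trace = (L * T * T).trace := by
    have a1 : (dL * T).trace = ((1 - E) * dL * T).trace := by
      have : T = T * (1 - E) := by rw [mul_sub, hTE]; simp
      conv_lhs => rw [this, ← mul_assoc, Matrix.trace_mul_comm, ← mul_assoc]
    have a2 : (L * dE * T).trace = 0 := by
      have b1 : E * (T * L) = 0 := by rw [← mul_assoc, hET, zero_mul]
      have b2 : (T * L) * E = 0 := by rw [mul_assoc, hLE, ← mul_assoc, hTE, zero_mul]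
      rw [mul_assoc, Matrix.trace_mul_comm, mul_assoc, ← hdEE, add_mul, mul_assoc, b1, mul_zero,
        zero_add, Matrix.trace_mul_comm, ← mul_assoc, b2, zero_mul, Matrix.trace_zero]
    rw [a1, h4, sub_mul, Matrix.trace_sub, a2, sub_zero]
  -- Differentiating tr(LT) = 0: the terms tr(LTT) from dL and from the Riccati equation cancel,
  -- leaving tr(LQ).
  have h6 := trace_twistedDeriv D N (L * T)
  rw [h1, map_zero, twistedDeriv_mul, Matrix.trace_add, ← hdL, h5, hT, mul_sub, Matrix.trace_sub,
    mul_neg, Matrix.trace_neg, mul_assoc] at h6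
  linear_combination -h6

end Matrix
end

/-! ### Structure equations over a ring of functions, and Cartan's identity -/

noncomputable section

/-- The structure equations of a hypersurface of a space form over a commutative ring of functions
with commuting derivations `∂ i`, together with a unit eigenvector field `Z` of the shape operator
`A` with the constant simple eigenvalue `lam`. -/
structure FrameEquations (R W n : Type*) [CommRing R] [Algebra ℂ R] [AddCommGroup W] [Module R W]
    [Fintype n] [DecidableEq n] where
  /-- the partial derivatives of functions -/
  der : n → Derivation ℂ R R
  /-- the partial derivatives of vector-valued functions -/
  vder : n → W →+ W
  vder_smul : ∀ i r w, vder i (r • w) = der i r • w + r • vder i w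
  vder_comm : ∀ i j w, vder i (vder j w) = vder j (vder i w)
  /-- the pseudo-inner product -/
  B : LinearMap.BilinForm R W
  B_symm : ∀ u v, B u v = B v u
  der_B : ∀ i u v, der i (B u v) = B (vder i u) v + B u (vder i v)
  /-- the position vector -/
  F : W
  /-- the unit normal -/
  ξ : W
  /-- the matrix of the shape operator -/
  A : Matrix n n R
  κ : ℂ
  ν : ℂ
  lam : ℂ
  sq_ν : ν * ν = 1
  sq_κ : κ * κ = κ
  vder_ξ : ∀ i, vder i ξ = -∑ j, A j i • vder j F
  B_ξ_ξ : B ξ ξ = algebraMap ℂ R ν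
  -- The factor κ treats both ambient spaces at once: for κ = 0 the conditions on the position
  -- vector become empty.
  B_F_F : algebraMap ℂ R κ * B F F = algebraMap ℂ R κ
  B_F_ξ : algebraMap ℂ R κ * B F ξ = 0
  B_vder_ξ : ∀ i, B (vder i F) ξ = 0
  exists_of_orthogonal : ∀ w, B w ξ = 0 → algebraMap ℂ R κ * B w F = 0 →
    ∃ X : n → R, w = ∑ i, X i • vder i F
  eq_zero_of_orthogonal : ∀ X : n → R, (∀ j, B (∑ i, X i • vder i F) (vder j F) = 0) → X = 0
  /-- the eigenvector field -/
  Z : n → R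
  A_mulVec_Z : A.mulVec Z = algebraMap ℂ R lam • Z
  unit_Z : B (∑ i, Z i • vder i F) (∑ i, Z i • vder i F) = 1
  eigenspace : ∀ X : n → R, A.mulVec X = algebraMap ℂ R lam • X →
    X = B (∑ i, X i • vder i F) (∑ i, Z i • vder i F) • Z

namespace FrameEquations

theorem mulVec_col {R n : Type*} [CommRing R] [Fintype n] (X Y : Matrix n n R) (j : n) :
    X.mulVec (fun k => Y k j) = fun k => (X * Y) k j := rfl

variable {R W n : Type*} [CommRing R] [Algebra ℂ R] [AddCommGroup W] [Module R W]
  [Fintype n] [DecidableEq n] (S : FrameEquations R W n)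

/-- The differential of the immersion. -/
def P : (n → R) →ₗ[R] W := Fintype.linearCombination R (fun i => S.vder i S.F)

theorem P_apply (X : n → R) : S.P X = ∑ i, X i • S.vder i S.F := rfl

/-- The constants as elements of the function ring. -/
abbrev cst (R : Type*) [CommRing R] [Algebra ℂ R] (c : ℂ) : R := algebraMap ℂ R c

theorem P_single (j : n) : S.P (Pi.single j 1) = S.vder j S.F := by
  simp [P, Fintype.linearCombination_apply]

theorem vder_ξ' (i : n) : S.vder i S.ξ = -S.P (fun j => S.A j i) := S.vder_ξ i

theorem B_P_ξ (X : n → R) : S.B (S.P X) S.ξ = 0 := by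
  simp [P_apply, S.B_vder_ξ]

theorem two_cancel {r : R} (h : r + r = 0) : r = 0 := by
  have : IsUnit (algebraMap ℂ R 2) := (two_ne_zero (α := ℂ)).isUnit.map _
  refine (this.mul_right_eq_zero).1 ?_
  rw [map_ofNat, two_mul, h]

theorem der_cst (i : n) (c : ℂ) : S.der i (cst R c) = 0 := by simp [cst]

theorem B_vder_F (i : n) : cst R S.κ * S.B (S.vder i S.F) S.F = 0 := by
  have h := congrArg (S.der i) S.B_F_F
  rw [Derivation.leibniz, der_cst, S.der_B, S.B_symm S.F (S.vder i S.F)] at h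
  apply two_cancel
  simpa [mul_add] using h

theorem B_P_F (X : n → R) : cst R S.κ * S.B (S.P X) S.F = 0 := by
  rw [P_apply]
  simp only [map_sum, map_smul, LinearMap.sum_apply, LinearMap.smul_apply, smul_eq_mul,
    Finset.mul_sum]
  refine Finset.sum_eq_zero fun i _ => ?_
  rw [mul_left_comm, B_vder_F, mul_zero]

theorem P_injective {X : n → R} (h : ∀ Y, S.B (S.P X) (S.P Y) = 0) : X = 0 :=
  S.eq_zero_of_orthogonal X fun j => by rw [← P_single]; exact h _

theorem mulVec_eq_sum (X : n → R) : S.A.mulVec X = ∑ i, X i • (fun j => S.A j i) := by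
  ext j
  simp [Matrix.mulVec, dotProduct, mul_comm]

/-- Both sides are the second fundamental form ⟨∂_i∂_j F, ξ⟩, and partial derivatives commute. -/
theorem A_symm_basis (i j : n) :
    S.B (S.P (fun k => S.A k i)) (S.vder j S.F) = S.B (S.P (fun k => S.A k j)) (S.vder i S.F) := by
  have h : ∀ i j, S.B (S.P (fun k => S.A k i)) (S.vder j S.F) =
      S.B (S.vder i (S.vder j S.F)) S.ξ := by
    intro i j
    have h := congrArg (S.der i) (S.B_vder_ξ j)
    rw [S.der_B, S.vder_ξ', map_neg, map_zero, S.B_symm (S.vder j S.F)] at h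
    linear_combination -h
  rw [h, h, S.vder_comm]

theorem A_symm (X Y : n → R) : S.B (S.P (S.A.mulVec X)) (S.P Y) = S.B (S.P X) (S.P (S.A.mulVec Y)) := by
  rw [S.B_symm (S.P X)]
  simp only [mulVec_eq_sum, map_sum, map_smul, LinearMap.sum_apply, LinearMap.smul_apply]
  rw [P_apply, P_apply]
  simp only [map_sum, map_smul, smul_eq_mul, Finset.mul_sum]
  rw [Finset.sum_comm]
  refine Finset.sum_congr rfl fun i _ => Finset.sum_congr rfl fun j _ => ?_
  rw [S.A_symm_basis]
  ring

/-- The image of `Z` in the ambient space. -/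
def ζ : W := S.P S.Z

/-- The derivative of functions along `Z`. -/
def D : Derivation ℂ R R := ∑ i, S.Z i • S.der i

theorem D_apply (r : R) : S.D r = ∑ i, S.Z i * S.der i r := by
  simp only [D, ← Derivation.coeFnAddMonoidHom_apply, map_sum, Finset.sum_apply]
  rfl

/-- The derivative of vector-valued functions along `Z`. -/
def vD (w : W) : W := ∑ i, S.Z i • S.vder i w

theorem vD_add (u v : W) : S.vD (u + v) = S.vD u + S.vD v := by
  simp [vD, Finset.sum_add_distrib]

theorem vD_neg (u : W) : S.vD (-u) = -S.vD u := by
  simp [vD]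

theorem vD_sum {ι : Type*} (s : Finset ι) (u : ι → W) : S.vD (∑ i ∈ s, u i) = ∑ i ∈ s, S.vD (u i) := by
  simp only [vD, map_sum, Finset.smul_sum]
  exact Finset.sum_comm

theorem vD_smul (r : R) (w : W) : S.vD (r • w) = S.D r • w + r • S.vD w := by
  simp only [vD, S.vder_smul, D_apply, Finset.sum_smul, smul_add, Finset.sum_add_distrib,
    Finset.smul_sum, smul_smul]
  simp only [mul_comm r]

theorem D_B (u v : W) : S.D (S.B u v) = S.B (S.vD u) v + S.B u (S.vD v) := by
  simp [vD, D_apply, S.der_B, mul_add, Finset.sum_add_distrib]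

theorem vD_F : S.vD S.F = S.ζ := rfl

theorem vD_ξ : S.vD S.ξ = -(cst R S.lam • S.ζ) := by
  have : S.vD S.ξ = -S.P (S.A.mulVec S.Z) := by
    simp [vD, vder_ξ', mulVec_eq_sum]
  rw [this, S.A_mulVec_Z, map_smul]
  rfl

/-- The derivative of `Z`, as a matrix. -/
def N : Matrix n n R := Matrix.of fun k j => S.der j (S.Z k)

/-- The bracket of ∂_j with Z is ∑ (∂_j Z^i) ∂_i. Hence `Matrix.twistedDeriv S.D S.N` is the Lie
derivative along Z of endomorphism fields, in coordinates. -/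
theorem vder_vD (j : n) (w : W) :
    S.vder j (S.vD w) = S.vD (S.vder j w) + ∑ i, S.N i j • S.vder i w := by
  simp only [vD, map_sum, S.vder_smul, Finset.sum_add_distrib, N, Matrix.of_apply]
  rw [add_comm]
  congr 1
  exact Finset.sum_congr rfl fun i _ => by rw [S.vder_comm]

/-- The focal map, up to a factor. -/
def η : W := cst R S.lam • S.F + S.ξ

theorem vder_smul_cst (i : n) (c : ℂ) (w : W) : S.vder i (cst R c • w) = cst R c • S.vder i w := by
  rw [S.vder_smul, der_cst, zero_smul, zero_add]

theorem D_cst (c : ℂ) : S.D (cst R c) = 0 := by simp [cst]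

theorem vD_smul_cst (c : ℂ) (w : W) : S.vD (cst R c • w) = cst R c • S.vD w := by
  rw [S.vD_smul, D_cst, zero_smul, zero_add]

theorem vD_η : S.vD S.η = 0 := by
  rw [η, S.vD_add, S.vD_smul_cst, S.vD_F, S.vD_ξ]; simp

theorem vder_η (j : n) : S.vder j S.η = S.P (cst R S.lam • Pi.single j 1 - fun k => S.A k j) := by
  rw [η, map_add, vder_smul_cst, map_sub, map_smul, P_single, vder_ξ', sub_eq_add_neg]

theorem mulVec_single (j : n) : S.A.mulVec (Pi.single j 1) = fun k => S.A k j := by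
  ext k; simp

/-- The differential of η is λ - A, whose image is orthogonal to its kernel since A is self-adjoint.
-/
theorem B_ζ_vder_η (j : n) : S.B S.ζ (S.vder j S.η) = 0 := by
  rw [vder_η, ← S.mulVec_single, map_sub, map_sub, ζ, ← S.A_symm, S.A_mulVec_Z,
    map_smul, map_smul, map_smul, LinearMap.map_smul₂, sub_self]

/-- Differentiate the previous relation along Z. As η is constant along Z, the derivative of ∂_jη
along Z is again a combination of the ∂_iη, all orthogonal to Z. -/
theorem B_vD_ζ_vder_η (j : n) : S.B (S.vD S.ζ) (S.vder j S.η) = 0 := by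
  have h := congrArg S.D (S.B_ζ_vder_η j)
  have h2 := S.vder_vD j S.η
  rw [vD_η, map_zero] at h2
  rw [D_B, map_zero, eq_neg_of_add_eq_zero_left h2.symm] at h
  simpa [B_ζ_vder_η] using h

theorem B_ζ_ζ : S.B S.ζ S.ζ = 1 := S.unit_Z

/-- The second derivative of the immersion along `Z`. -/
def μ : W := cst R (S.ν * S.lam) • S.ξ - cst R S.κ • S.F

theorem B_P_μ (X : n → R) : S.B (S.P X) S.μ = 0 := by
  simp [μ, B_P_ξ, B_P_F]

theorem B_μ_ξ : S.B S.μ S.ξ = cst R S.lam := by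
  simp only [μ, map_sub, LinearMap.sub_apply, map_smul, LinearMap.smul_apply, smul_eq_mul,
    S.B_F_ξ, S.B_ξ_ξ, sub_zero]
  rw [← map_mul, mul_right_comm, S.sq_ν, one_mul]

theorem B_μ_F : cst R S.κ * S.B S.μ S.F = -cst R S.κ := by
  simp only [μ, map_sub, LinearMap.sub_apply, map_smul, LinearMap.smul_apply, smul_eq_mul]
  have h1 := S.B_F_ξ
  have h2 := S.B_F_F
  have h3 : cst R S.κ * cst R S.κ = (cst R S.κ : R) := by rw [cst, ← map_mul, S.sq_κ]
  rw [S.B_symm] at h1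
  linear_combination cst R (S.ν * S.lam) * h1 - cst R S.κ * h2 - h3

/-- Lines of curvature of a simple constant principal curvature are geodesics. The tangential part X
of the second derivative is orthogonal to the image of λ - A, so X lies in its kernel and is a
multiple of Z; but X is orthogonal to Z because ⟨Z,Z⟩ = 1. -/
theorem vD_ζ : S.vD S.ζ = S.μ := by
  have a1 : S.B (S.vD S.ζ) S.ξ = cst R S.lam := by
    have h := S.D_B S.ζ S.ξ
    rw [vD_ξ, ζ, B_P_ξ, ← ζ, map_zero, map_neg, map_smul, B_ζ_ζ, smul_eq_mul, mul_one] at h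
    linear_combination -h
  have a2 : cst R S.κ * S.B (S.vD S.ζ) S.F = -cst R S.κ := by
    have h := congrArg S.D (S.B_P_F S.Z)
    rw [Derivation.leibniz, D_cst, D_B, vD_F, ← ζ, B_ζ_ζ, map_zero] at h
    simp only [smul_eq_mul] at h
    linear_combination h
  obtain ⟨X, hX⟩ := S.exists_of_orthogonal (S.vD S.ζ - S.μ)
    (by rw [map_sub, LinearMap.sub_apply, a1, B_μ_ξ, sub_self])
    (by rw [map_sub, LinearMap.sub_apply, mul_sub, a2, B_μ_F, sub_self])
  rw [← P_apply] at hX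
  have a3 : S.B (S.vD S.ζ) S.ζ = 0 := by
    have h := S.D_B S.ζ S.ζ
    rw [S.B_symm S.ζ (S.vD S.ζ), B_ζ_ζ, Derivation.map_one_eq_zero] at h
    exact two_cancel h.symm
  have a4 : ∀ Y, S.B S.μ (S.P Y) = 0 := fun Y => by rw [S.B_symm, B_P_μ]
  have a5 : S.B (S.P X) S.ζ = 0 := by
    rw [← hX, map_sub, LinearMap.sub_apply, a3, ζ, a4, sub_zero]
  have a6 : ∀ j, S.B (S.P X) (S.vder j S.η) = 0 := fun j => by
    rw [← hX, map_sub, LinearMap.sub_apply, B_vD_ζ_vder_η, vder_η, a4, sub_zero]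
  have a7 : cst R S.lam • X - S.A.mulVec X = 0 := by
    refine S.eq_zero_of_orthogonal _ fun j => ?_
    have h := a6 j
    rw [vder_η, ← S.mulVec_single, map_sub, map_sub, ← S.A_symm, map_smul, map_smul,
      P_single] at h
    rw [← P_apply, map_sub, map_smul, map_sub, map_smul, LinearMap.sub_apply, LinearMap.smul_apply,
      h]
  have a8 := S.eigenspace X (sub_eq_zero.1 a7).symm
  rw [← P_apply, ← P_apply, ← ζ, a5, zero_smul] at a8
  rw [a8, map_zero] at hX
  exact sub_eq_zero.1 hX

/-- The covector dual to `Z`. -/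
def z (j : n) : R := S.B S.ζ (S.vder j S.F)

/-- Differentiating ⟨Z,ξ⟩ = 0 and κ⟨Z,F⟩ = 0 gives the normal components of ∂_jζ, which are those of
z_j μ. The remaining tangential part is the covariant derivative of Z. -/
theorem exists_T (j : n) : ∃ X : n → R, S.vder j S.ζ = S.P X + S.z j • S.μ := by
  have a1 : S.B (S.vder j S.ζ) S.ξ = cst R S.lam * S.z j := by
    have h := S.der_B j S.ζ S.ξ
    rw [vder_ξ', ← S.mulVec_single, ζ, B_P_ξ, map_zero, map_neg, ← S.A_symm, S.A_mulVec_Z,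
      map_smul, map_smul, P_single, ← ζ, LinearMap.smul_apply, ← z, smul_eq_mul] at h
    linear_combination -h
  have a2 : cst R S.κ * S.B (S.vder j S.ζ) S.F = -(cst R S.κ * S.z j) := by
    have h := congrArg (S.der j) (S.B_P_F S.Z)
    rw [Derivation.leibniz, der_cst, S.der_B, ← ζ, map_zero, ← z] at h
    simp only [smul_eq_mul] at h
    linear_combination h
  obtain ⟨X, hX⟩ := S.exists_of_orthogonal (S.vder j S.ζ - S.z j • S.μ)
    (by rw [map_sub, LinearMap.sub_apply, map_smul, LinearMap.smul_apply, a1, B_μ_ξ, smul_eq_mul,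
          mul_comm, sub_self])
    (by
      rw [map_sub, LinearMap.sub_apply, map_smul, LinearMap.smul_apply, mul_sub, a2, smul_eq_mul]
      linear_combination (-S.z j) * S.B_μ_F)
  exact ⟨X, by rw [P_apply, ← hX, sub_add_cancel]⟩

/-- The matrix of the covariant derivative of `Z`. -/
def T : Matrix n n R := Matrix.of fun k j => (S.exists_T j).choose k

theorem vder_ζ (j : n) : S.vder j S.ζ = S.P (fun k => S.T k j) + S.z j • S.μ :=
  (S.exists_T j).choose_spec

theorem P_mulVec (X : Matrix n n R) (Y : n → R) :
    S.P (X.mulVec Y) = ∑ i, Y i • S.P (fun k => X k i) := by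
  have : X.mulVec Y = ∑ i, Y i • (fun k => X k i) := by
    ext j
    simp [Matrix.mulVec, dotProduct, mul_comm]
  rw [this]
  simp

theorem B_ζ_P (X : n → R) : S.B S.ζ (S.P X) = ∑ i, X i * S.z i := by
  simp [P_apply, z]

theorem vD_vder_F (j : n) :
    S.vD (S.vder j S.F) = S.P (fun k => S.T k j) - S.P (fun k => S.N k j) + S.z j • S.μ := by
  have h := S.vder_vD j S.F
  rw [vD_F, vder_ζ] at h
  rw [← sub_eq_iff_eq_add.2 h, P_apply S (fun k => S.N k j)]
  abel

theorem vD_P (X : n → R) :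
    S.vD (S.P X) = S.P ((fun k => S.D (X k)) + S.T.mulVec X - S.N.mulVec X) +
      S.B S.ζ (S.P X) • S.μ := by
  conv_lhs => rw [P_apply]
  simp only [vD_sum, vD_smul, vD_vder_F, smul_add, smul_sub, Finset.sum_add_distrib,
    Finset.sum_sub_distrib]
  rw [map_sub, map_add, P_mulVec, P_mulVec, B_ζ_P, P_apply, Finset.sum_smul]
  simp only [mul_smul]
  abel

/-- μ is orthogonal to the hypersurface and the metric is non-degenerate, so tangential parts can be
compared modulo μ. -/
theorem P_eq_smul_μ {X : n → R} {r : R} (h : S.P X = r • S.μ) : X = 0 := by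
  refine S.P_injective fun Y => ?_
  rw [h, map_smul, LinearMap.smul_apply, S.B_symm, B_P_μ, smul_zero]

/-- The Codazzi equation: it follows from commuting ∂_j with Z on η, which is constant along Z and
has differential λ - A. -/
theorem deriv_A : Matrix.twistedDeriv S.D S.N S.A =
    -(S.T * (S.A - algebraMap ℂ (Matrix n n R) S.lam)) := by
  set σ : Matrix n n R := algebraMap ℂ (Matrix n n R) S.lam - S.A with hσ
  have hη : ∀ j, S.vder j S.η = S.P (fun k => σ k j) := by
    intro j
    rw [vder_η]
    congr 1
    ext k
    by_cases hkj : k = j <;>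
      simp [hσ, hkj, Algebra.algebraMap_eq_smul_one]
  have h : Matrix.twistedDeriv S.D S.N σ = -(S.T * σ) := by
    have : σ.map S.D + S.T * σ - S.N * σ + σ * S.N = 0 := by
      ext k j
      have h2 := S.vder_vD j S.η
      rw [vD_η, map_zero, hη, vD_P, ← hη, B_ζ_vder_η] at h2
      simp only [hη] at h2
      rw [← P_mulVec S σ (fun k => S.N k j), zero_smul, add_zero, ← map_add] at h2
      exact congrFun (S.P_eq_smul_μ (r := 0) (by rw [← h2, zero_smul])) k
    rw [Matrix.twistedDeriv, ← sub_eq_zero, ← this]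
    abel
  rw [hσ, Matrix.twistedDeriv_sub, Matrix.twistedDeriv_algebraMap, ← hσ, zero_sub] at h
  rw [neg_inj.1 h, hσ]
  noncomm_ring

theorem vder_μ (j : n) : S.vder j S.μ =
    -S.P (cst R (S.ν * S.lam) • (fun k => S.A k j) + cst R S.κ • Pi.single j 1) := by
  rw [μ, map_sub, vder_smul_cst, vder_smul_cst, vder_ξ', map_add, map_smul, map_smul, P_single]
  rw [smul_neg]
  abel

theorem vD_μ : S.vD S.μ = -(cst R (S.κ + S.ν * S.lam * S.lam) • S.ζ) := by
  rw [μ, sub_eq_add_neg, vD_add, vD_neg, vD_smul_cst, vD_smul_cst, vD_ξ, vD_F]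
  simp only [cst, map_add, map_mul]
  module

theorem sum_Z_z : ∑ i, S.Z i * S.z i = 1 := by
  rw [← B_ζ_P]; exact S.B_ζ_ζ

/-- ∇_Z Z = 0 in coordinates; the dual relation below comes from ⟨Z,Z⟩ = 1. -/
theorem T_mulVec_Z : S.T.mulVec S.Z = 0 := by
  have h := S.vD_ζ
  simp only [vD, vder_ζ, smul_add, Finset.sum_add_distrib] at h
  rw [← P_mulVec] at h
  simp only [smul_smul] at h
  rw [← Finset.sum_smul, sum_Z_z, one_smul] at h
  exact S.P_eq_smul_μ (r := 0) (by simpa using h)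

theorem z_vecMul_T : Matrix.vecMul S.z S.T = 0 := by
  ext j
  have h := S.der_B j S.ζ S.ζ
  rw [S.B_symm (S.vder j S.ζ), B_ζ_ζ, Derivation.map_one_eq_zero] at h
  have h' := two_cancel h.symm
  rw [vder_ζ, map_add, map_smul, B_ζ_P, ζ, B_P_μ, smul_zero, add_zero] at h'
  rw [Pi.zero_apply, ← h']
  simp [Matrix.vecMul, dotProduct, mul_comm]

/-- The Riccati equation. Apply ∂_j to `vD_ζ`, commute it with Z and take tangential parts; the
curvature term, as in the Gauss equation, comes from ∂_jμ and from the derivative of μ along Z. -/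
theorem deriv_T : Matrix.twistedDeriv S.D S.N S.T =
    -(S.T * S.T) - (cst R (S.ν * S.lam) • S.A + cst R S.κ • 1 -
      cst R (S.κ + S.ν * S.lam * S.lam) • Matrix.vecMulVec S.Z S.z) := by
  rw [Matrix.twistedDeriv, ← sub_eq_zero]
  ext k j
  have h := S.vder_vD j S.ζ
  have h1 : ∑ i, S.N i j • S.vder i S.ζ =
      S.P (S.T.mulVec fun k => S.N k j) + (∑ i, S.N i j * S.z i) • S.μ := by
    simp only [vder_ζ, smul_add, Finset.sum_add_distrib, P_mulVec, Finset.sum_smul, mul_smul]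
  rw [vD_ζ, vder_μ, h1, vder_ζ, vD_add, vD_smul, vD_P, vD_μ] at h
  have h2 := congrFun (S.P_eq_smul_μ
    (X := (fun k => S.D (S.T k j)) + S.T.mulVec (fun k => S.T k j) - S.N.mulVec (fun k => S.T k j)
      + S.T.mulVec (fun k => S.N k j) + (cst R (S.ν * S.lam) • (fun k => S.A k j) +
        cst R S.κ • Pi.single j 1) - (S.z j * cst R (S.κ + S.ν * S.lam * S.lam)) • S.Z)
    (r := -(S.B S.ζ (S.P fun k => S.T k j) + S.D (S.z j) + ∑ i, S.N i j * S.z i)) (by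
      rw [map_sub, map_add, map_add, map_smul _ (S.z j * _), ← ζ]
      rw [← sub_eq_zero] at h ⊢
      rw [← neg_eq_zero, ← h]
      module)) k
  simp only [Pi.add_apply, Pi.sub_apply, Pi.smul_apply, smul_eq_mul, Pi.zero_apply,
    Pi.single_apply, mulVec_col] at h2
  simp only [Matrix.sub_apply, Matrix.add_apply, Matrix.neg_apply, Matrix.smul_apply,
    Matrix.map_apply, Matrix.vecMulVec_apply, Matrix.one_apply, smul_eq_mul, Matrix.zero_apply]
  linear_combination h2

/-- Cartan's identity for the simple principal curvature `lam`, in the form of a trace. -/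
theorem trace_eq_zero (e l : Polynomial ℂ) (hE : Polynomial.aeval S.A e = Matrix.vecMulVec S.Z S.z)
    (hl : l * (Polynomial.X - Polynomial.C S.lam) = 1 - e)
    (htr : ∀ (k : ℕ) (i : n), S.der i (S.A ^ k).trace = 0) :
    (Polynomial.aeval S.A l * (cst R (S.ν * S.lam) • S.A + cst R S.κ • 1 -
      cst R (S.κ + S.ν * S.lam * S.lam) • Polynomial.aeval S.A e)).trace = 0 := by
  refine Matrix.trace_eq_zero_of_riccati S.D S.N S.A S.T _ _ S.lam e l rfl ?_ hl ?_ ?_ S.deriv_A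
    (by rw [hE, S.deriv_T]) fun k => by simp [D_apply, htr]
  · rw [hE, Matrix.vecMulVec_mul_vecMulVec]
    have : S.z ⬝ᵥ S.Z = 1 := by
      rw [← S.sum_Z_z]; simp [dotProduct, mul_comm]
    simp [this]
  · rw [hE, Matrix.mul_vecMulVec, T_mulVec_Z, Matrix.zero_vecMulVec]
  · rw [hE, Matrix.vecMulVec_mul, z_vecMul_T, Matrix.vecMulVec_zero]

end FrameEquations
end

/-! ### Smooth complex functions on an open set -/

noncomputable section

open TopologicalSpace (Opens)

variable {E : Type*} [NormedAddCommGroup E]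

/-- The extension by zero of a function on an open set. -/
def zeroExtension {U : Opens E} (f : U → ℂ) : E → ℂ := Function.extend Subtype.val f 0

theorem zeroExtension_apply {U : Opens E} (f : U → ℂ) (x : U) : zeroExtension f x = f x :=
  Subtype.val_injective.extend_apply _ _ _

theorem zeroExtension_restrict {U : Opens E} (f : E → ℂ) :
    Set.EqOn (zeroExtension fun x : U => f x) f U :=
  fun x hx => zeroExtension_apply (fun x : U => f x) ⟨x, hx⟩

variable [NormedSpace ℝ E]

/-- The algebra of smooth complex functions on an open subset of a normed space. -/
def SmoothFun (U : Opens E) : Subalgebra ℂ (U → ℂ) where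
  carrier := {f | ContDiffOn ℝ ∞ (zeroExtension f) U}
  mul_mem' {f g} hf hg := (ContDiffOn.mul hf hg).congr fun x hx => by
    change _ = zeroExtension f x * zeroExtension g x
    lift x to U using hx
    simp [zeroExtension_apply]
  add_mem' {f g} hf hg := (ContDiffOn.add hf hg).congr fun x hx => by
    lift x to U using hx
    simp [zeroExtension_apply]
  algebraMap_mem' c := (contDiffOn_const (c := c)).congr fun x hx => by
    lift x to U using hx
    simp [zeroExtension_apply]

namespace SmoothFun

variable {U : Opens E}

instance : CoeFun (SmoothFun U) fun _ => U → ℂ := ⟨fun f => f.1⟩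

@[ext]
theorem ext {f g : SmoothFun U} (h : ∀ x, f x = g x) : f = g := Subtype.ext (funext h)

theorem contDiffOn (f : SmoothFun U) : ContDiffOn ℝ ∞ (zeroExtension f) U := f.2

theorem contDiffAt (f : SmoothFun U) (x : U) : ContDiffAt ℝ ∞ (zeroExtension f) x :=
  (contDiffOn f).contDiffAt (U.isOpen.mem_nhds x.2)

theorem differentiableAt (f : SmoothFun U) (x : U) : DifferentiableAt ℝ (zeroExtension f) x :=
  (contDiffAt f x).differentiableAt (by simp)

/-- The restriction of a function to an open set where it is smooth. -/
def mk (f : E → ℂ) (hf : ContDiffOn ℝ ∞ f U) : SmoothFun U :=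
  ⟨fun x => f x, hf.congr (zeroExtension_restrict f)⟩

@[simp]
theorem mk_apply (f : E → ℂ) (hf : ContDiffOn ℝ ∞ f U) (x : U) : mk f hf x = f x := rfl

@[simp] theorem mul_apply (f g : SmoothFun U) (x : U) : (f * g) x = f x * g x := rfl
@[simp] theorem add_apply (f g : SmoothFun U) (x : U) : (f + g) x = f x + g x := rfl
@[simp] theorem sub_apply (f g : SmoothFun U) (x : U) : (f - g) x = f x - g x := rfl
@[simp] theorem neg_apply (f : SmoothFun U) (x : U) : (-f) x = -f x := rfl
@[simp] theorem one_apply (x : U) : (1 : SmoothFun U) x = 1 := rfl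
@[simp] theorem zero_apply (x : U) : (0 : SmoothFun U) x = 0 := rfl
@[simp] theorem algebraMap_apply (c : ℂ) (x : U) : algebraMap ℂ (SmoothFun U) c x = c := rfl

/-- The evaluation at a point. -/
def eval (x : U) : SmoothFun U →ₐ[ℂ] ℂ := (Pi.evalAlgHom ℂ (fun _ => ℂ) x).comp (SmoothFun U).val

theorem eval_apply (x : U) (f : SmoothFun U) : eval x f = f x := rfl

@[simp] theorem sum_apply {ι : Type*} (s : Finset ι) (f : ι → SmoothFun U) (x : U) :
    (∑ i ∈ s, f i) x = ∑ i ∈ s, f i x := by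
  rw [← eval_apply, map_sum]
  rfl

theorem fderiv_zeroExtension_congr {f : U → ℂ} {g : E → ℂ} (h : ∀ x : U, f x = g x) (x : U) :
    fderiv ℝ (zeroExtension f) x = fderiv ℝ g x := by
  refine Filter.EventuallyEq.fderiv_eq ?_
  filter_upwards [U.isOpen.mem_nhds x.2] with y hy
  rw [← h ⟨y, hy⟩]
  exact zeroExtension_apply f ⟨y, hy⟩

/-- The derivative in a direction. -/
def dirDeriv (v : E) : Derivation ℂ (SmoothFun U) (SmoothFun U) :=
  Derivation.mk'
    { toFun := fun f => mk (fun x => fderiv ℝ (zeroExtension f) x v)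
        (((contDiffOn f).fderiv_of_isOpen U.isOpen (by simp)).clm_apply contDiffOn_const)
      map_add' := fun f g => by
        ext x
        have : fderiv ℝ (zeroExtension (f + g)) x =
            fderiv ℝ (zeroExtension f + zeroExtension g) x :=
          fderiv_zeroExtension_congr (f := f + g) (fun x => by simp [zeroExtension_apply]) x
        rw [fderiv_add (differentiableAt f x) (differentiableAt g x)] at this
        exact DFunLike.congr_fun this v
      map_smul' := fun c f => by
        ext x
        have : fderiv ℝ (zeroExtension (c • f.1)) x = fderiv ℝ (c • zeroExtension f) x :=
          fderiv_zeroExtension_congr (f := c • f.1) (fun x => by simp [zeroExtension_apply]) x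
        rw [fderiv_const_smul (differentiableAt f x)] at this
        exact DFunLike.congr_fun this v }
    fun f g => by
      ext x
      have : fderiv ℝ (zeroExtension (f * g)) x =
          fderiv ℝ (zeroExtension f * zeroExtension g) x :=
        fderiv_zeroExtension_congr (f := f * g) (fun x => by simp [zeroExtension_apply]) x
      rw [fderiv_mul (differentiableAt f x) (differentiableAt g x)] at this
      have := DFunLike.congr_fun this v
      refine this.trans ?_
      simp [zeroExtension_apply]

theorem dirDeriv_apply (v : E) (f : SmoothFun U) (x : U) :
    dirDeriv v f x = fderiv ℝ (zeroExtension f) x v := rfl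

@[simp]
theorem dirDeriv_mk (v : E) (f : E → ℂ) (hf : ContDiffOn ℝ ∞ f U) (x : U) :
    dirDeriv v (mk f hf) x = fderiv ℝ f x v := by
  rw [dirDeriv_apply, fderiv_zeroExtension_congr (g := f) (fun _ => mk_apply _ _ _)]

theorem dirDeriv_comm (v w : E) (f : SmoothFun U) :
    dirDeriv v (dirDeriv w f) = dirDeriv w (dirDeriv v f) := by
  ext x
  have hs : IsSymmSndFDerivAt ℝ (zeroExtension f) x :=
    (contDiffAt f x).isSymmSndFDerivAt (by
      rw [minSmoothness_of_isRCLikeNormedField]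
      exact WithTop.coe_le_coe.2 (le_top : (2 : ℕ∞) ≤ ⊤))
  have hd : DifferentiableAt ℝ (fderiv ℝ (zeroExtension f)) x :=
    ((contDiffAt f x).fderiv_right (m := ∞) (by simp)).differentiableAt (by simp)
  have h : ∀ v w : E, dirDeriv v (dirDeriv w f) x =
      fderiv ℝ (fderiv ℝ (zeroExtension f)) x v w := by
    intro v w
    rw [dirDeriv_apply, fderiv_zeroExtension_congr (g := fun x => fderiv ℝ (zeroExtension f) x w)
      (fun _ => dirDeriv_apply _ _ _), fderiv_clm_apply hd (differentiableAt_const w)]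
    simp
  rw [h, h, hs.eq]

theorem isUnit_of_ne_zero (f : SmoothFun U) (hf : ∀ x, f x ≠ 0) : IsUnit f := by
  refine IsUnit.of_mul_eq_one (mk (fun x => (zeroExtension f x)⁻¹)
    ((contDiffOn f).inv fun x hx => ?_)) ?_
  · rw [zeroExtension_apply f ⟨x, hx⟩]; exact hf _
  · ext x
    simp [zeroExtension_apply, hf]

/-- The principal logarithm is smooth on the slit plane, so exp(log f / 2) is a smooth root. -/
theorem exists_sq_eq (f : SmoothFun U) (hf : ∀ x, f x ∈ Complex.slitPlane) :
    ∃ g : SmoothFun U, g * g = f := by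
  have h : ∀ x ∈ U, zeroExtension f x ∈ Complex.slitPlane := fun x hx => by
    rw [zeroExtension_apply f ⟨x, hx⟩]; exact hf _
  refine ⟨mk (fun x => Complex.exp (Complex.log (zeroExtension f x) / 2)) ?_, ?_⟩
  · have hlog : ContDiffOn ℝ ∞ (fun x => Complex.log (zeroExtension f x)) U := fun x hx =>
      ((Complex.contDiffAt_log (h x hx)).restrict_scalars ℝ).comp_contDiffWithinAt x
        (contDiffOn f x hx)
    exact (hlog.div_const 2).cexp
  · ext x
    rw [mul_apply, mk_apply, ← Complex.exp_add, add_halves, zeroExtension_apply,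
      Complex.exp_log (Complex.slitPlane_ne_zero (hf x))]

end SmoothFun
end

/-! ### The complex normal form and local hypersurfaces -/

noncomputable section

open TopologicalSpace (Opens)

theorem pseudoInner_apply {m s : ℕ} (u v : EuclideanSpace ℝ (Fin m)) :
    pseudoInner m s u v = ∑ i : Fin m, (if (i : ℕ) < s then -1 else 1) * (u i * v i) := rfl

/-- The shape operator of Petrov type IV. -/
def petrovMatrix (α β b : ℝ) : Matrix (Fin 4) (Fin 4) ℝ :=
  !![α, -β, 0, 0; β, α, 0, 0; 0, 0, b, 1; 0, 0, 0, b]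

/-- The metric of Petrov type IV. -/
def petrovMetric (ε : ℝ) : Matrix (Fin 4) (Fin 4) ℝ :=
  !![-1, 0, 0, 0; 0, 1, 0, 0; 0, 0, 0, ε; 0, 0, ε, 0]

/-- The complex normal form of `petrovMatrix`. -/
def complexJordan (lam : ℂ) (b : ℝ) : Matrix (Fin 4) (Fin 4) ℂ :=
  !![lam, 0, 0, 0; 0, star lam, 0, 0; 0, 0, b, 1; 0, 0, 0, b]

/-- The metric belonging to `complexJordan`. -/
def complexMetric (ε : ℝ) : Matrix (Fin 4) (Fin 4) ℂ :=
  !![-2, 0, 0, 0; 0, -2, 0, 0; 0, 0, 0, ε; 0, 0, ε, 0]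

/-- The eigenvectors of `petrovMatrix`. -/
def diagonalizer : Matrix (Fin 4) (Fin 4) ℂ :=
  !![1, 1, 0, 0; -Complex.I, Complex.I, 0, 0; 0, 0, 1, 0; 0, 0, 0, 1]

/-- The matrix as a complex matrix. -/
abbrev Matrix.complexify {ι ι' : Type*} (X : Matrix ι ι' ℝ) : Matrix ι ι' ℂ := X.map Complex.ofRealHom

theorem petrovMatrix_mul_diagonalizer (α β b : ℝ) :
    (petrovMatrix α β b).complexify * diagonalizer =
      diagonalizer * complexJordan (α + β * Complex.I) b := by
  have hI := Complex.I_mul_I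
  ext i j
  fin_cases i <;> fin_cases j <;>
    simp [petrovMatrix, diagonalizer, complexJordan, Matrix.mul_apply, Fin.sum_univ_four] <;>
    linear_combination (β : ℂ) * hI

/-- The eigenvectors (1, ∓i) are mutually orthogonal and have square -1 + (∓i)² = -2; in particular
they are not null. -/
theorem petrovMetric_conj (ε : ℝ) :
    diagonalizer.transpose * (petrovMetric ε).complexify * diagonalizer = complexMetric ε := by
  have hI := Complex.I_mul_I
  ext i j
  fin_cases i <;> fin_cases j <;>
    simp [petrovMetric, diagonalizer, complexMetric, Matrix.mul_apply, Fin.sum_univ_four] <;>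
    norm_num

theorem det_complexMetric {ε : ℝ} (hε : ε = 1 ∨ ε = -1) : (complexMetric ε).det ≠ 0 := by
  rcases hε with rfl | rfl <;>
  simp [complexMetric, Matrix.det_succ_row_zero, Fin.sum_univ_succ, Fin.succAbove]

/-- A local parametrization `F` with unit normal `ξ` of a hypersurface of a space form of curvature
`κ`, with constant principal curvatures `α ± iβ`, `b`, `b` and Petrov type IV. -/
structure LocalHypersurface {m : ℕ} (κ α β b : ℝ)
    (F ξ : EuclideanSpace ℝ (Fin 4) → EuclideanSpace ℝ (Fin m))
    (U : Opens (EuclideanSpace ℝ (Fin 4))) : Prop where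
  pos_β : 0 < β
  sq_κ : κ * κ = κ
  contDiffOn_F : ContDiffOn ℝ ∞ F U
  contDiffOn_ξ : ContDiffOn ℝ ∞ ξ U
  form_ξ_ξ : ∀ x ∈ U, pseudoInner m 2 (ξ x) (ξ x) = 1
  form_F_F : ∀ x ∈ U, κ * pseudoInner m 2 (F x) (F x) = κ
  form_F_ξ : ∀ x ∈ U, κ * pseudoInner m 2 (F x) (ξ x) = 0
  form_fderiv_ξ : ∀ x ∈ U, ∀ v, pseudoInner m 2 (fderiv ℝ F x v) (ξ x) = 0
  nondegenerate : ∀ x ∈ U, ∀ u, (∀ v, pseudoInner m 2 u (fderiv ℝ F x v) = 0) →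
    pseudoInner m 2 u (ξ x) = 0 → κ * pseudoInner m 2 u (F x) = 0 → u = 0
  frame : ∀ x ∈ U, ∃ (f : Fin 4 → EuclideanSpace ℝ (Fin 4)) (ε : ℝ), (ε = 1 ∨ ε = -1) ∧
    (∀ j, fderiv ℝ ξ x (f j) = -∑ i, petrovMatrix α β b i j • fderiv ℝ F x (f i)) ∧
    ∀ i j, pseudoInner m 2 (fderiv ℝ F x (f i)) (fderiv ℝ F x (f j)) = petrovMetric ε i j

namespace LocalHypersurface

variable {m : ℕ} {κ α β b : ℝ} {F ξ : EuclideanSpace ℝ (Fin 4) → EuclideanSpace ℝ (Fin m)}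
  {U : Opens (EuclideanSpace ℝ (Fin 4))}

theorem mono (H : LocalHypersurface κ α β b F ξ U) {U' : Opens (EuclideanSpace ℝ (Fin 4))}
    (h : U' ≤ U) : LocalHypersurface κ α β b F ξ U' where
  pos_β := H.pos_β
  sq_κ := H.sq_κ
  contDiffOn_F := H.contDiffOn_F.mono h
  contDiffOn_ξ := H.contDiffOn_ξ.mono h
  form_ξ_ξ x hx := H.form_ξ_ξ x (h hx)
  form_F_F x hx := H.form_F_F x (h hx)
  form_F_ξ x hx := H.form_F_ξ x (h hx)
  form_fderiv_ξ x hx := H.form_fderiv_ξ x (h hx)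
  nondegenerate x hx := H.nondegenerate x (h hx)
  frame x hx := H.frame x (h hx)

/-- The coordinate vectors. -/
abbrev stdVec (i : Fin 4) : EuclideanSpace ℝ (Fin 4) := EuclideanSpace.single i 1

theorem eq_sum_stdVec (v : EuclideanSpace ℝ (Fin 4)) : v = ∑ k, v k • stdVec k := by
  ext i
  simp [stdVec, Pi.single_apply]

variable (F ξ) in
/-- The Gram matrix of the coordinate frame. -/
def gram (x : EuclideanSpace ℝ (Fin 4)) : Matrix (Fin 4) (Fin 4) ℝ :=
  Matrix.of fun i j => pseudoInner m 2 (fderiv ℝ F x (stdVec i)) (fderiv ℝ F x (stdVec j))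

variable (F ξ) in
/-- The second fundamental form in the coordinate frame. -/
def sff (x : EuclideanSpace ℝ (Fin 4)) : Matrix (Fin 4) (Fin 4) ℝ :=
  Matrix.of fun i j => -pseudoInner m 2 (fderiv ℝ F x (stdVec i)) (fderiv ℝ ξ x (stdVec j))

theorem exists_frame_matrix (H : LocalHypersurface κ α β b F ξ U)
    {x : EuclideanSpace ℝ (Fin 4)} (hx : x ∈ U) :
    ∃ (Q : Matrix (Fin 4) (Fin 4) ℝ) (ε : ℝ), (ε = 1 ∨ ε = -1) ∧
      Q.transpose * gram F x * Q = petrovMetric ε ∧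
      sff F ξ x * Q = gram F x * Q * petrovMatrix α β b := by
  obtain ⟨f, ε, hε, h1, h2⟩ := H.frame x hx
  refine ⟨Matrix.of fun k i => f i k, ε, hε, ?_, ?_⟩
  · ext i j
    rw [← h2 i j]
    conv_rhs => rw [eq_sum_stdVec (f i), eq_sum_stdVec (f j)]
    simp only [map_sum, map_smul, LinearMap.sum_apply, LinearMap.smul_apply, Matrix.mul_apply, gram,
      Matrix.transpose_apply, Matrix.of_apply, smul_eq_mul, Finset.mul_sum, Finset.sum_mul]
    exact Finset.sum_congr rfl fun _ _ => Finset.sum_congr rfl fun _ _ => by ring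
  · have hg : ∀ k i, (gram F x * Matrix.of fun k i => f i k) k i =
        pseudoInner m 2 (fderiv ℝ F x (stdVec k)) (fderiv ℝ F x (f i)) := by
      intro k i
      conv_rhs => rw [eq_sum_stdVec (f i)]
      simp only [map_sum, map_smul, Matrix.mul_apply, gram, Matrix.of_apply, smul_eq_mul]
      exact Finset.sum_congr rfl fun _ _ => by ring
    ext k j
    rw [Matrix.mul_apply (M := gram F x * _)]
    simp only [hg]
    have h3 := congrArg (pseudoInner m 2 (fderiv ℝ F x (stdVec k))) (h1 j)
    conv_lhs at h3 => rw [eq_sum_stdVec (f j)]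
    simp only [map_neg, map_sum, map_smul, smul_eq_mul] at h3
    simp only [Matrix.mul_apply, sff, Matrix.of_apply]
    rw [← neg_inj, ← Finset.sum_neg_distrib]
    refine Eq.trans ?_ (h3.trans ?_)
    · exact Finset.sum_congr rfl fun _ _ => by ring
    · rw [neg_inj]
      exact Finset.sum_congr rfl fun _ _ => by ring

theorem exists_complex_frame (H : LocalHypersurface κ α β b F ξ U)
    {x : EuclideanSpace ℝ (Fin 4)} (hx : x ∈ U) :
    ∃ (Q : Matrix (Fin 4) (Fin 4) ℂ) (ε : ℝ), (ε = 1 ∨ ε = -1) ∧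
      Q.transpose * (gram F x).complexify * Q = complexMetric ε ∧
      (sff F ξ x).complexify * Q = (gram F x).complexify * Q *
        complexJordan (α + β * Complex.I) b := by
  obtain ⟨Q, ε, hε, h1, h2⟩ := H.exists_frame_matrix hx
  refine ⟨Q.complexify * diagonalizer, ε, hε, ?_, ?_⟩
  · rw [← petrovMetric_conj, ← h1]
    simp only [Matrix.complexify, Matrix.map_mul, Matrix.transpose_mul, Matrix.transpose_map,
      Matrix.mul_assoc]
  · rw [← Matrix.mul_assoc, Matrix.complexify, Matrix.complexify, ← Matrix.map_mul, h2,
      Matrix.map_mul, Matrix.map_mul, Matrix.mul_assoc, petrovMatrix_mul_diagonalizer]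
    simp only [Matrix.mul_assoc]

theorem det_gram_ne_zero (H : LocalHypersurface κ α β b F ξ U)
    {x : EuclideanSpace ℝ (Fin 4)} (hx : x ∈ U) : (gram F x).complexify.det ≠ 0 := by
  obtain ⟨Q, ε, hε, h1, -⟩ := H.exists_complex_frame hx
  intro h
  refine det_complexMetric hε ?_
  rw [← h1, Matrix.det_mul, Matrix.det_mul, h]
  simp

end LocalHypersurface
end

/-! ### The structure equations of a local hypersurface -/

noncomputable section

open TopologicalSpace (Opens)

namespace SmoothFun

section Vector

variable {E : Type*} [NormedAddCommGroup E] [NormedSpace ℝ E] {U : Opens E} {m : ℕ}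

/-- The derivative of a vector-valued function in a direction. -/
def vecDirDeriv (v : E) : (Fin m → SmoothFun U) →+ (Fin m → SmoothFun U) where
  toFun w a := dirDeriv v (w a)
  map_zero' := by ext; simp
  map_add' u w := by ext; simp

theorem vecDirDeriv_apply (v : E) (w : Fin m → SmoothFun U) (a : Fin m) :
    vecDirDeriv v w a = dirDeriv v (w a) := rfl

/-- The pseudo-inner product of vector-valued functions. -/
def form (m s : ℕ) (U : Opens E) : LinearMap.BilinForm (SmoothFun U) (Fin m → SmoothFun U) :=
  LinearMap.mk₂ _ (fun u v => ∑ i : Fin m, (if (i : ℕ) < s then -1 else 1) * (u i * v i))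
    (fun u u' v => by
      simp only [Pi.add_apply, add_mul, mul_add, Finset.sum_add_distrib])
    (fun c u v => by
      simp only [Pi.smul_apply, smul_eq_mul, Finset.mul_sum]
      exact Finset.sum_congr rfl fun i _ => by ring)
    (fun u v v' => by
      simp only [Pi.add_apply, mul_add, Finset.sum_add_distrib])
    (fun c u v => by
      simp only [Pi.smul_apply, smul_eq_mul, Finset.mul_sum]
      exact Finset.sum_congr rfl fun i _ => by ring)

theorem form_apply (s : ℕ) (u v : Fin m → SmoothFun U) :
    form m s U u v = ∑ i : Fin m, (if (i : ℕ) < s then -1 else 1) * (u i * v i) := rfl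

theorem form_symm (s : ℕ) (u v : Fin m → SmoothFun U) : form m s U u v = form m s U v u := by
  simp only [form_apply]
  exact Finset.sum_congr rfl fun i _ => by ring

theorem dirDeriv_form (w : E) (s : ℕ) (u v : Fin m → SmoothFun U) :
    dirDeriv w (form m s U u v) = form m s U (vecDirDeriv w u) v + form m s U u (vecDirDeriv w v) := by
  simp only [form_apply, map_sum, ← Finset.sum_add_distrib]
  refine Finset.sum_congr rfl fun i _ => ?_
  split_ifs <;> simp [vecDirDeriv_apply] <;> ring

theorem form_eval (s : ℕ) (u v : Fin m → SmoothFun U) (x : U) :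
    form m s U u v x = ∑ i : Fin m, (if (i : ℕ) < s then -1 else 1) * (u i x * v i x) := by
  rw [form_apply, sum_apply]
  refine Finset.sum_congr rfl fun i _ => ?_
  split_ifs <;> simp

theorem contDiffOn_ofReal_coord {f : E → EuclideanSpace ℝ (Fin m)} (hf : ContDiffOn ℝ ∞ f U)
    (a : Fin m) : ContDiffOn ℝ ∞ (fun x => (f x a : ℂ)) U :=
  Complex.ofRealCLM.contDiff.comp_contDiffOn (contDiffOn_euclidean.1 hf a)

/-- A smooth vector-valued function, as a tuple of smooth functions. -/
def vecMk (f : E → EuclideanSpace ℝ (Fin m)) (hf : ContDiffOn ℝ ∞ f U) : Fin m → SmoothFun U :=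
  fun a => mk (fun x => (f x a : ℂ)) (contDiffOn_ofReal_coord hf a)

theorem vecDirDeriv_vecMk (v : E) (f : E → EuclideanSpace ℝ (Fin m)) (hf : ContDiffOn ℝ ∞ f U)
    (a : Fin m) (x : U) : vecDirDeriv v (vecMk f hf) a x = (fderiv ℝ f x v a : ℂ) := by
  rw [vecDirDeriv_apply, vecMk, dirDeriv_mk]
  have hd : HasFDerivAt f (fderiv ℝ f x) x :=
    ((hf.contDiffAt (U.isOpen.mem_nhds x.2)).differentiableAt (by simp)).hasFDerivAt
  have h := (Complex.ofRealCLM.comp (EuclideanSpace.proj a : _ →L[ℝ] ℝ)).hasFDerivAt.comp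
    (x : E) hd
  have h2 := h.fderiv
  exact DFunLike.congr_fun h2 v

end Vector

end SmoothFun

namespace LocalHypersurface

open SmoothFun

variable {m : ℕ} {κ α β b : ℝ} {F ξ : EuclideanSpace ℝ (Fin 4) → EuclideanSpace ℝ (Fin m)}
  {U : Opens (EuclideanSpace ℝ (Fin 4))}

theorem sum_neg_smul {R W ι : Type*} [Ring R] [AddCommGroup W] [Module R W] [Fintype ι]
    (f : ι → R) (w : ι → W) : ∑ i, (-f) i • w i = -∑ i, f i • w i := by
  simp

/-- If the vector-valued functions take real values at a point, their pseudo-inner product is that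
of the values. -/
theorem form_eval_real {u v : Fin m → SmoothFun U} {x : U} {u' v' : EuclideanSpace ℝ (Fin m)}
    (hu : ∀ a, u a x = u' a) (hv : ∀ a, v a x = v' a) :
    form m 2 U u v x = (pseudoInner m 2 u' v' : ℂ) := by
  rw [form_eval, pseudoInner_apply]
  push_cast
  refine Finset.sum_congr rfl fun i _ => ?_
  rw [hu, hv]
  split_ifs <;> simp

theorem re_form_eval {u v : Fin m → SmoothFun U} {x : U} {v' : EuclideanSpace ℝ (Fin m)}
    (hv : ∀ a, v a x = v' a) :
    (form m 2 U u v x).re = pseudoInner m 2 (WithLp.toLp 2 fun a => (u a x).re) v' := by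
  rw [form_eval, pseudoInner_apply, Complex.re_sum]
  refine Finset.sum_congr rfl fun i _ => ?_
  rw [hv]
  split_ifs <;> simp

theorem im_form_eval {u v : Fin m → SmoothFun U} {x : U} {v' : EuclideanSpace ℝ (Fin m)}
    (hv : ∀ a, v a x = v' a) :
    (form m 2 U u v x).im = pseudoInner m 2 (WithLp.toLp 2 fun a => (u a x).im) v' := by
  rw [form_eval, pseudoInner_apply, Complex.im_sum]
  refine Finset.sum_congr rfl fun i _ => ?_
  rw [hv]
  split_ifs <;> simp

variable (H : LocalHypersurface κ α β b F ξ U)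

/-- The position vector as a tuple of smooth functions. -/
def position : Fin m → SmoothFun U := vecMk F H.contDiffOn_F

/-- The unit normal as a tuple of smooth functions. -/
def unitNormal : Fin m → SmoothFun U := vecMk ξ H.contDiffOn_ξ

/-- The coordinate tangent vectors. -/
def coordVec (i : Fin 4) : Fin m → SmoothFun U := vecDirDeriv (stdVec i) H.position

theorem position_eval (x : U) (a : Fin m) : H.position a x = F x a := rfl

theorem unitNormal_eval (x : U) (a : Fin m) : H.unitNormal a x = ξ x a := rfl

theorem coordVec_eval (i : Fin 4) (x : U) (a : Fin m) :
    H.coordVec i a x = fderiv ℝ F x (stdVec i) a := vecDirDeriv_vecMk _ _ _ _ _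

theorem deriv_unitNormal_eval (i : Fin 4) (x : U) (a : Fin m) :
    vecDirDeriv (stdVec i) H.unitNormal a x = fderiv ℝ ξ x (stdVec i) a :=
  vecDirDeriv_vecMk _ _ _ _ _

theorem form_unitNormal : form m 2 U H.unitNormal H.unitNormal = 1 := by
  ext x
  rw [form_eval_real (H.unitNormal_eval x) (H.unitNormal_eval x), H.form_ξ_ξ x x.2]
  simp

theorem form_position : algebraMap ℂ (SmoothFun U) κ * form m 2 U H.position H.position =
    algebraMap ℂ (SmoothFun U) κ := by
  ext x
  rw [mul_apply, form_eval_real (H.position_eval x) (H.position_eval x), SmoothFun.algebraMap_apply]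
  exact_mod_cast H.form_F_F x x.2

theorem form_position_unitNormal :
    algebraMap ℂ (SmoothFun U) κ * form m 2 U H.position H.unitNormal = 0 := by
  ext x
  rw [mul_apply, form_eval_real (H.position_eval x) (H.unitNormal_eval x), SmoothFun.algebraMap_apply,
    SmoothFun.zero_apply]
  exact_mod_cast H.form_F_ξ x x.2

theorem form_coordVec_unitNormal (i : Fin 4) : form m 2 U (H.coordVec i) H.unitNormal = 0 := by
  ext x
  rw [form_eval_real (H.coordVec_eval i x) (H.unitNormal_eval x), H.form_fderiv_ξ x x.2]
  simp

/-- The Gram matrix of smooth functions. -/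
def gramFun : Matrix (Fin 4) (Fin 4) (SmoothFun U) :=
  Matrix.of fun i j => form m 2 U (H.coordVec i) (H.coordVec j)

/-- The second fundamental form as a matrix of smooth functions. -/
def sffFun : Matrix (Fin 4) (Fin 4) (SmoothFun U) :=
  Matrix.of fun i j => -form m 2 U (H.coordVec i) (vecDirDeriv (stdVec j) H.unitNormal)

theorem gramFun_eval (x : U) : H.gramFun.map (eval x) = (gram F x).complexify := by
  ext i j
  exact form_eval_real (H.coordVec_eval i x) (H.coordVec_eval j x)

theorem sffFun_eval (x : U) : H.sffFun.map (eval x) = (sff F ξ x).complexify := by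
  ext i j
  have := form_eval_real (H.coordVec_eval i x) (H.deriv_unitNormal_eval j x)
  simp [sffFun, sff, eval_apply, this]

theorem isUnit_det_gramFun : IsUnit H.gramFun.det := by
  refine isUnit_of_ne_zero _ fun x => ?_
  rw [← eval_apply, AlgHom.map_det, AlgHom.mapMatrix_apply, gramFun_eval]
  exact H.det_gram_ne_zero x.2

/-- The shape operator as a matrix of smooth functions. -/
def shape : Matrix (Fin 4) (Fin 4) (SmoothFun U) := H.gramFun⁻¹ * H.sffFun

theorem gramFun_mul_shape : H.gramFun * H.shape = H.sffFun := by
  rw [shape, Matrix.mul_nonsing_inv_cancel_left _ _ H.isUnit_det_gramFun]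

theorem form_comb (X : Fin 4 → SmoothFun U) (j : Fin 4) :
    form m 2 U (∑ i, X i • H.coordVec i) (H.coordVec j) = H.gramFun.mulVec X j := by
  simp only [map_sum, map_smul, LinearMap.sum_apply, LinearMap.smul_apply, Matrix.mulVec, dotProduct,
    gramFun, Matrix.of_apply, smul_eq_mul]
  exact Finset.sum_congr rfl fun i _ => by rw [form_symm, mul_comm]

theorem eq_zero_of_gramFun_mulVec {X : Fin 4 → SmoothFun U} (h : H.gramFun.mulVec X = 0) :
    X = 0 := by
  have := congrArg (H.gramFun⁻¹.mulVec) h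
  rwa [Matrix.mulVec_mulVec, Matrix.nonsing_inv_mul _ H.isUnit_det_gramFun, Matrix.one_mulVec,
    Matrix.mulVec_zero] at this

/-- The vectors paired with w are real, so the real and imaginary parts of w satisfy the hypotheses
separately and real non-degeneracy applies to each. -/
theorem eq_zero_of_form_eq_zero (w : Fin m → SmoothFun U)
    (h1 : ∀ j, form m 2 U w (H.coordVec j) = 0) (h2 : form m 2 U w H.unitNormal = 0)
    (h3 : algebraMap ℂ (SmoothFun U) κ * form m 2 U w H.position = 0) : w = 0 := by
  have h1' : ∀ (x : U) j, form m 2 U w (H.coordVec j) x = 0 := fun x j => by rw [h1]; rfl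
  have h2' : ∀ (x : U), form m 2 U w H.unitNormal x = 0 := fun x => by rw [h2]; rfl
  have h3' : ∀ (x : U), (κ : ℂ) * form m 2 U w H.position x = 0 := fun x => by
    rw [← SmoothFun.algebraMap_apply κ x, ← mul_apply, h3]; rfl
  have ext4 : ∀ (x : U) (u : EuclideanSpace ℝ (Fin m)),
      (∀ j, pseudoInner m 2 u (fderiv ℝ F x (stdVec j)) = 0) →
      ∀ v, pseudoInner m 2 u (fderiv ℝ F x v) = 0 := by
    intro x u hu v
    rw [eq_sum_stdVec v]
    simp [hu]
  have hre : ∀ x : U, (WithLp.toLp 2 fun a => (w a x).re : EuclideanSpace ℝ (Fin m)) = 0 := by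
    intro x
    refine H.nondegenerate x x.2 _ (ext4 x _ fun j => ?_) ?_ ?_
    · rw [← re_form_eval (H.coordVec_eval j x), h1']; rfl
    · rw [← re_form_eval (H.unitNormal_eval x), h2']; rfl
    · rw [← re_form_eval (H.position_eval x), ← Complex.re_ofReal_mul, h3']; rfl
  have him : ∀ x : U, (WithLp.toLp 2 fun a => (w a x).im : EuclideanSpace ℝ (Fin m)) = 0 := by
    intro x
    refine H.nondegenerate x x.2 _ (ext4 x _ fun j => ?_) ?_ ?_
    · rw [← im_form_eval (H.coordVec_eval j x), h1']; rfl
    · rw [← im_form_eval (H.unitNormal_eval x), h2']; rfl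
    · rw [← im_form_eval (H.position_eval x), ← Complex.im_ofReal_mul, h3']; rfl
  ext a x
  refine Complex.ext ?_ ?_
  · exact congrFun (congrArg WithLp.ofLp (hre x)) a
  · exact congrFun (congrArg WithLp.ofLp (him x)) a

theorem form_coordVec_position (i : Fin 4) :
    algebraMap ℂ (SmoothFun U) κ * form m 2 U (H.coordVec i) H.position = 0 := by
  have h := congrArg (dirDeriv (stdVec i)) H.form_position
  rw [Derivation.leibniz, Derivation.map_algebraMap, dirDeriv_form,
    form_symm 2 H.position] at h
  apply FrameEquations.two_cancel
  simpa [mul_add, coordVec] using h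

/-- The coefficients come from the inverse Gram matrix; the remainder is orthogonal to the
coordinate frame, to ξ and to κF, hence zero. -/
theorem exists_eq_comb (w : Fin m → SmoothFun U) (h2 : form m 2 U w H.unitNormal = 0)
    (h3 : algebraMap ℂ (SmoothFun U) κ * form m 2 U w H.position = 0) :
    ∃ X : Fin 4 → SmoothFun U, w = ∑ i, X i • H.coordVec i := by
  set X := H.gramFun⁻¹.mulVec fun j => form m 2 U w (H.coordVec j) with hX
  refine ⟨X, sub_eq_zero.1 (H.eq_zero_of_form_eq_zero _ (fun j => ?_) ?_ ?_)⟩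
  · rw [map_sub, LinearMap.sub_apply, form_comb, hX, Matrix.mulVec_mulVec,
      Matrix.mul_nonsing_inv _ H.isUnit_det_gramFun, Matrix.one_mulVec, sub_self]
  · simp [h2, form_coordVec_unitNormal]
  · rw [map_sub, LinearMap.sub_apply, mul_sub, h3, map_sum, LinearMap.sum_apply, Finset.mul_sum,
      zero_sub, neg_eq_zero]
    refine Finset.sum_eq_zero fun i _ => ?_
    rw [map_smul, LinearMap.smul_apply, smul_eq_mul, mul_left_comm, form_coordVec_position, mul_zero]

theorem deriv_unitNormal (i : Fin 4) :
    vecDirDeriv (stdVec i) H.unitNormal = -∑ j, H.shape j i • H.coordVec j := by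
  have h2 : form m 2 U (vecDirDeriv (stdVec i) H.unitNormal) H.unitNormal = 0 := by
    have h := dirDeriv_form (stdVec i) 2 H.unitNormal H.unitNormal
    rw [H.form_unitNormal, Derivation.map_one_eq_zero, form_symm 2 H.unitNormal] at h
    exact FrameEquations.two_cancel h.symm
  have h3 : algebraMap ℂ (SmoothFun U) κ *
      form m 2 U (vecDirDeriv (stdVec i) H.unitNormal) H.position = 0 := by
    have h := congrArg (dirDeriv (stdVec i)) H.form_position_unitNormal
    rw [Derivation.leibniz, Derivation.map_algebraMap, dirDeriv_form, ← coordVec,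
      form_coordVec_unitNormal, form_symm 2 H.position] at h
    simpa using h
  obtain ⟨X, hX⟩ := H.exists_eq_comb _ h2 h3
  have h4 : H.gramFun.mulVec (X + fun k => H.shape k i) = 0 := by
    ext1 j
    rw [Matrix.mulVec_add, FrameEquations.mulVec_col, gramFun_mul_shape, Pi.add_apply, ← form_comb,
      ← hX, sffFun, Matrix.of_apply, form_symm, add_neg_cancel, Pi.zero_apply]
  have h5 := H.eq_zero_of_gramFun_mulVec h4
  rw [hX, eq_neg_of_add_eq_zero_left h5]
  exact sum_neg_smul (fun k => H.shape k i) H.coordVec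

/-- The constant complex principal curvature. -/
abbrev curv (α β : ℝ) : ℂ := α + β * Complex.I

/-- The frame equations of a local hypersurface. -/
def frameEquations (Z : Fin 4 → SmoothFun U)
    (hZ : H.shape.mulVec Z = algebraMap ℂ (SmoothFun U) (curv α β) • Z)
    (hZZ : form m 2 U (∑ i, Z i • H.coordVec i) (∑ i, Z i • H.coordVec i) = 1)
    (heig : ∀ X : Fin 4 → SmoothFun U, H.shape.mulVec X =
      algebraMap ℂ (SmoothFun U) (curv α β) • X →
      X = form m 2 U (∑ i, X i • H.coordVec i) (∑ i, Z i • H.coordVec i) • Z) :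
    FrameEquations (SmoothFun U) (Fin m → SmoothFun U) (Fin 4) where
  der i := dirDeriv (stdVec i)
  vder i := vecDirDeriv (stdVec i)
  vder_smul i r w := by
    ext1 a
    simp [vecDirDeriv_apply, mul_comm, add_comm]
  vder_comm i j w := by
    ext1 a
    exact dirDeriv_comm _ _ _
  B := form m 2 U
  B_symm := form_symm 2
  der_B i := dirDeriv_form (stdVec i) 2
  F := H.position
  ξ := H.unitNormal
  A := H.shape
  κ := κ
  ν := 1
  lam := curv α β
  sq_ν := one_mul 1
  sq_κ := by exact_mod_cast H.sq_κ
  vder_ξ := H.deriv_unitNormal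
  B_ξ_ξ := by rw [map_one]; exact H.form_unitNormal
  B_F_F := H.form_position
  B_F_ξ := H.form_position_unitNormal
  B_vder_ξ := H.form_coordVec_unitNormal
  exists_of_orthogonal := H.exists_eq_comb
  eq_zero_of_orthogonal X h := H.eq_zero_of_gramFun_mulVec (funext fun j => by
    rw [← form_comb]; exact h j)
  Z := Z
  A_mulVec_Z := hZ
  unit_Z := hZZ
  eigenspace := heig

end LocalHypersurface
end

/-! ### Spectral projection, unit eigenvector field and contradiction -/

noncomputable section

open TopologicalSpace (Opens)

section Conjugation

variable {n R : Type*} [Fintype n] [DecidableEq n] [CommRing R]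

theorem Matrix.pow_mul_eq_of_mul_eq {A Q J : Matrix n n R} (h : A * Q = Q * J) (k : ℕ) :
    A ^ k * Q = Q * J ^ k := by
  induction k with
  | zero => simp
  | succ k ih => rw [pow_succ', mul_assoc, ih, ← mul_assoc, h, mul_assoc, ← pow_succ']

theorem Matrix.trace_eq_of_mul_eq {A Q J : Matrix n n R} (h : A * Q = Q * J) (hQ : IsUnit Q.det) :
    A.trace = J.trace := by
  have : A = Q * J * Q⁻¹ := by rw [← h, Matrix.mul_nonsing_inv_cancel_right _ _ hQ]
  rw [this, Matrix.trace_mul_comm, Matrix.nonsing_inv_mul_cancel_left _ _ hQ]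

variable [Algebra ℂ R]

theorem Matrix.aeval_mul_eq_of_mul_eq {A Q J : Matrix n n R} (h : A * Q = Q * J)
    (p : Polynomial ℂ) : Polynomial.aeval A p * Q = Q * Polynomial.aeval J p := by
  induction p using Polynomial.induction_on' with
  | add p q hp hq => simp [add_mul, mul_add, hp, hq]
  | monomial k c =>
    rw [Polynomial.aeval_monomial, Polynomial.aeval_monomial, mul_assoc,
      Matrix.pow_mul_eq_of_mul_eq h, ← mul_assoc, Algebra.commutes, mul_assoc]

theorem Matrix.aeval_mulVec_of_eigenvector {A : Matrix n n R} {X : n → R} {c : ℂ}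
    (h : A.mulVec X = algebraMap ℂ R c • X) (p : Polynomial ℂ) :
    (Polynomial.aeval A p).mulVec X = algebraMap ℂ R (p.eval c) • X := by
  have hk : ∀ k : ℕ, (A ^ k).mulVec X = algebraMap ℂ R (c ^ k) • X := by
    intro k
    induction k with
    | zero => simp
    | succ k ih =>
      rw [pow_succ, ← Matrix.mulVec_mulVec, h, Matrix.mulVec_smul, ih, smul_smul, ← map_mul,
        pow_succ']
  induction p using Polynomial.induction_on' with
  | add p q hp hq => simp [Matrix.add_mulVec, hp, hq, add_smul]
  | monomial k a =>
    rw [Polynomial.aeval_monomial, Polynomial.eval_monomial, Algebra.algebraMap_eq_smul_one,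
      smul_one_mul, ← algebraMap_smul R a (A ^ k), Matrix.smul_mulVec, hk, smul_smul, map_mul]

theorem Matrix.aeval_mul_linear (A : Matrix n n R) (l e : Polynomial ℂ) (a c d : ℂ) :
    Polynomial.aeval A (l * (Polynomial.C a * Polynomial.X + Polynomial.C c - Polynomial.C d * e)) =
      Polynomial.aeval A l * (algebraMap ℂ R a • A + algebraMap ℂ R c • 1 -
        algebraMap ℂ R d • Polynomial.aeval A e) := by
  simp only [map_mul, map_add, map_sub, Polynomial.aeval_C, Polynomial.aeval_X,
    Algebra.algebraMap_eq_smul_one, smul_one_mul]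
  simp

end Conjugation

theorem eq_of_mul_eq_of_isUnit_det {n : Type*} [Fintype n] [DecidableEq n] {X Y Q : Matrix n n ℂ}
    (hQ : IsUnit Q.det) (h : X * Q = Y * Q) : X = Y := by
  rw [← Matrix.mul_nonsing_inv_cancel_right Q X hQ, h, Matrix.mul_nonsing_inv_cancel_right Q Y hQ]

/-- The spectral projection onto the first coordinate. -/
def firstProj : Matrix (Fin 4) (Fin 4) ℂ := !![1, 0, 0, 0; 0, 0, 0, 0; 0, 0, 0, 0; 0, 0, 0, 0]

/-- The polynomial whose value at `complexJordan` is the spectral projection. -/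
def projPoly (lam : ℂ) (b : ℝ) : Polynomial ℂ :=
  Polynomial.C (((lam - star lam) * (lam - b) ^ 2)⁻¹) *
    ((Polynomial.X - Polynomial.C (star lam)) * (Polynomial.X - Polynomial.C (b : ℂ)) ^ 2)

theorem projPoly_eval {lam : ℂ} {b : ℝ} (h1 : lam - star lam ≠ 0) (h2 : lam - b ≠ 0) :
    (projPoly lam b).eval lam = 1 := by
  simp only [projPoly, Polynomial.eval_mul, Polynomial.eval_C, Polynomial.eval_sub,
    Polynomial.eval_X, Polynomial.eval_pow]
  exact inv_mul_cancel₀ (mul_ne_zero h1 (pow_ne_zero 2 h2))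

/-- The square of X - b is needed to kill the Jordan block. -/
theorem aeval_projPoly {lam : ℂ} {b : ℝ} (h1 : lam - star lam ≠ 0) (h2 : lam - b ≠ 0) :
    Polynomial.aeval (complexJordan lam b) (projPoly lam b) = firstProj := by
  have h3 : (lam - star lam) * (lam - b) ^ 2 ≠ 0 := mul_ne_zero h1 (pow_ne_zero 2 h2)
  have h : (complexJordan lam b - algebraMap ℂ _ (star lam)) *
      (complexJordan lam b - algebraMap ℂ _ (b : ℂ)) ^ 2 =
      ((lam - star lam) * (lam - b) ^ 2) • firstProj := by
    ext i j
    fin_cases i <;> fin_cases j <;>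
      simp [complexJordan, firstProj, pow_two, Matrix.mul_apply, Fin.sum_univ_four,
        Matrix.algebraMap_matrix_apply]
  simp only [projPoly, map_mul, map_pow, map_sub, Polynomial.aeval_C, Polynomial.aeval_X, h]
  rw [Algebra.algebraMap_eq_smul_one, smul_mul_smul_comm, inv_mul_cancel₀ h3, one_mul, one_smul]

theorem complexJordan_mul_firstProj (lam : ℂ) (b : ℝ) :
    complexJordan lam b * firstProj = lam • firstProj := by
  ext i j
  fin_cases i <;> fin_cases j <;>
    simp [complexJordan, firstProj, Matrix.mul_apply, Fin.sum_univ_four]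

theorem eigenvector_complexJordan {lam : ℂ} {b : ℝ} (h1 : lam - star lam ≠ 0) (h2 : lam - b ≠ 0)
    {y : Fin 4 → ℂ} (hy : (complexJordan lam b).mulVec y = lam • y) : y = Pi.single 0 (y 0) := by
  have e1 := congrFun hy 1
  have e2 := congrFun hy 2
  have e3 := congrFun hy 3
  simp [complexJordan, Matrix.mulVec, dotProduct, Fin.sum_univ_four] at e1 e2 e3
  have y3 : y 3 = 0 := by
    rcases e3 with h | h
    · exact absurd (by rw [h, sub_self]) h2
    · exact h
  have y1 : y 1 = 0 := by
    rcases e1 with h | h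
    · exact absurd (by simp [h]) h1
    · exact h
  have y2 : y 2 = 0 := by
    refine (mul_eq_zero.1 ?_).resolve_left h2
    rw [y3] at e2
    linear_combination -e2
  ext i
  fin_cases i <;> simp [y1, y2, y3]

/-- Cartan's identity for the matrix `complexJordan`. -/
theorem cartan_of_trace_eq_zero {lam κ : ℂ} {b : ℝ} (h1 : lam - star lam ≠ 0) (h2 : lam - b ≠ 0)
    {L : Matrix (Fin 4) (Fin 4) ℂ}
    (hL : L * (complexJordan lam b - algebraMap ℂ _ lam) = 1 - firstProj)
    (htr : (L * (lam • complexJordan lam b + κ • 1 - (κ + lam * lam) • firstProj)).trace = 0) :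
    (lam * star lam + κ) * (b - lam) + 2 * (lam * b + κ) * (star lam - lam) = 0 := by
  have h1' : star lam - lam ≠ 0 := fun h => h1 (by linear_combination -h)
  have h2' : (b : ℂ) - lam ≠ 0 := fun h => h2 (by linear_combination -h)
  set Q := lam • complexJordan lam b + κ • 1 - (κ + lam * lam) • firstProj with hQ
  -- The explicit inverse of J - λ off the eigenline, J being `complexJordan lam b`. L agrees with
  -- it on the image of 1 - `firstProj`, which contains that of Q because the (0,0) entry of Q is λ²
  -- + κ - (κ + λ²) = 0.
  set K : Matrix (Fin 4) (Fin 4) ℂ := !![0, 0, 0, 0; 0, (star lam - lam)⁻¹, 0, 0;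
    0, 0, ((b : ℂ) - lam)⁻¹, -(((b : ℂ) - lam)⁻¹ * ((b : ℂ) - lam)⁻¹);
    0, 0, 0, ((b : ℂ) - lam)⁻¹] with hK
  have hSK : (complexJordan lam b - algebraMap ℂ _ lam) * K = 1 - firstProj := by
    have h1'' : (starRingEnd ℂ) lam - lam ≠ 0 := h1'
    ext i j
    fin_cases i <;> fin_cases j <;>
      simp [complexJordan, firstProj, hK, Matrix.mul_apply, Fin.sum_univ_four,
        Matrix.algebraMap_matrix_apply, h1'', h2']
  have hPQ : (1 - firstProj) * Q = Q := by
    ext i j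
    fin_cases i <;> fin_cases j <;>
      simp [complexJordan, firstProj, hQ, Matrix.mul_apply, Fin.sum_univ_four, Matrix.one_apply]
    all_goals ring
  have hPK : (1 - firstProj) * K = K := by
    ext i j
    fin_cases i <;> fin_cases j <;>
      simp [firstProj, hK, Matrix.mul_apply, Fin.sum_univ_four, Matrix.one_apply]
  have hLQ : L * Q = K * Q := by
    calc L * Q = L * ((complexJordan lam b - algebraMap ℂ _ lam) * K * Q) := by rw [hSK, hPQ]
      _ = K * Q := by rw [← mul_assoc, ← mul_assoc, hL, hPK]
  rw [hLQ] at htr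
  have htr' : (star lam - lam)⁻¹ * (lam * star lam + κ) +
      2 * (((b : ℂ) - lam)⁻¹ * (lam * b + κ)) = 0 := by
    rw [← htr]
    simp only [Matrix.trace, Matrix.diag_apply, Matrix.mul_apply, Fin.sum_univ_four]
    simp [hK, hQ, complexJordan, firstProj]
    ring
  field_simp at htr'
  linear_combination htr'

/-- The numerical contradiction in Cartan's identity. -/
theorem false_of_cartan {κ α β b : ℝ} (hβ : 0 < β) (hκ : κ * κ = κ)
    (h : ((α + β * Complex.I) * star (α + β * Complex.I : ℂ) + κ) * (b - (α + β * Complex.I)) +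
      2 * ((α + β * Complex.I) * b + κ) * (star (α + β * Complex.I : ℂ) - (α + β * Complex.I)) = 0) :
    False := by
  have hre := congrArg Complex.re h
  have him := congrArg Complex.im h
  simp at hre him
  have hκ0 : 0 ≤ κ := by rw [← hκ]; exact mul_self_nonneg κ
  set s := α ^ 2 + β ^ 2 + κ with hs
  have hs0 : 0 < s := by positivity
  have h1 : s * (b - α) + 4 * β ^ 2 * b = 0 := by rw [hs]; linear_combination hre
  have h2 : s + 4 * (α * b + κ) = 0 := by
    refine (mul_eq_zero.1 ?_).resolve_left hβ.ne'
    rw [hs]; linear_combination -him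
  -- The real part multiplied by b shows αb ≥ 0, whereas `h2`, the imaginary part divided by -β,
  -- makes αb negative.
  have h3 : s * (α * b) = (s + 4 * β ^ 2) * b ^ 2 := by linear_combination -b * h1
  have h4 : 0 ≤ s * (α * b) := by rw [h3]; positivity
  have h5 : 0 ≤ α * b := nonneg_of_mul_nonneg_right h4 hs0
  linarith

namespace LocalHypersurface

open SmoothFun

variable {m : ℕ} {κ α β b : ℝ} {F ξ : EuclideanSpace ℝ (Fin 4) → EuclideanSpace ℝ (Fin m)}
  {U : Opens (EuclideanSpace ℝ (Fin 4))}

theorem curv_sub_star_ne_zero (H : LocalHypersurface κ α β b F ξ U) : curv α β - star (curv α β) ≠ 0 := by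
  intro h
  have := congrArg Complex.im h
  simp at this
  linarith [H.pos_β]

theorem curv_sub_ne_zero (H : LocalHypersurface κ α β b F ξ U) : curv α β - b ≠ 0 := by
  intro h
  have := congrArg Complex.im h
  simp at this
  linarith [H.pos_β]

variable (H : LocalHypersurface κ α β b F ξ U)

theorem map_gramFun_mul_map_shape (x : U) :
    (gram F x).complexify * H.shape.map (eval x) = (sff F ξ x).complexify := by
  rw [← gramFun_eval H, ← sffFun_eval H, ← gramFun_mul_shape, Matrix.map_mul]

theorem map_aeval_shape (x : U) (p : Polynomial ℂ) :
    (Polynomial.aeval H.shape p).map (eval x) = Polynomial.aeval (H.shape.map (eval x)) p :=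
  (Polynomial.aeval_algHom_apply (eval x).mapMatrix H.shape p).symm

theorem exists_frame_shape (x : U) :
    ∃ (Q : Matrix (Fin 4) (Fin 4) ℂ) (ε : ℝ), IsUnit Q.det ∧
      Q.transpose * (gram F x).complexify * Q = complexMetric ε ∧
      H.shape.map (eval x) * Q = Q * complexJordan (curv α β) b := by
  obtain ⟨Q, ε, hε, h1, h2⟩ := H.exists_complex_frame x.2
  refine ⟨Q, ε, ?_, h1, ?_⟩
  · refine IsUnit.mk0 _ fun h => det_complexMetric hε ?_
    rw [← h1, Matrix.det_mul, h, mul_zero]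
  · have hg : IsUnit (gram F x).complexify.det := (H.det_gram_ne_zero x.2).isUnit
    have h3 := congrArg ((gram F x).complexify⁻¹ * ·) h2
    rw [← H.map_gramFun_mul_map_shape, Matrix.mul_assoc, Matrix.mul_assoc,
      Matrix.nonsing_inv_mul_cancel_left _ _ hg, Matrix.nonsing_inv_mul_cancel_left _ _ hg] at h3
    exact h3

theorem matrix_ext {X Y : Matrix (Fin 4) (Fin 4) (SmoothFun U)}
    (h : ∀ x : U, X.map (eval x) = Y.map (eval x)) : X = Y := by
  ext i j x
  exact congrFun (congrFun (h x) i) j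

theorem shape_mul_proj : H.shape * Polynomial.aeval H.shape (projPoly (curv α β) b) =
    algebraMap ℂ (SmoothFun U) (curv α β) • Polynomial.aeval H.shape (projPoly (curv α β) b) := by
  refine matrix_ext fun x => ?_
  obtain ⟨Q, ε, hQ, -, h2⟩ := H.exists_frame_shape x
  have h3 : ((algebraMap ℂ (SmoothFun U) (curv α β) •
      Polynomial.aeval H.shape (projPoly (curv α β) b)).map (eval x)) =
      curv α β • Polynomial.aeval (H.shape.map (eval x)) (projPoly (curv α β) b) := by
    rw [← map_aeval_shape]
    ext i j
    simp [eval_apply]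
  rw [h3, Matrix.map_mul, map_aeval_shape]
  refine eq_of_mul_eq_of_isUnit_det hQ ?_
  rw [Matrix.mul_assoc, Matrix.smul_mul, Matrix.aeval_mul_eq_of_mul_eq h2,
    aeval_projPoly H.curv_sub_star_ne_zero H.curv_sub_ne_zero, ← Matrix.mul_assoc, h2,
    Matrix.mul_assoc, complexJordan_mul_firstProj, Matrix.mul_smul]

theorem form_comb_comb (X Y : Fin 4 → SmoothFun U) :
    form m 2 U (∑ i, X i • H.coordVec i) (∑ i, Y i • H.coordVec i) =
      Y ⬝ᵥ H.gramFun.mulVec X := by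
  rw [map_sum]
  simp only [map_smul, form_comb, dotProduct, smul_eq_mul]

theorem map_mulVec (x : U) (M : Matrix (Fin 4) (Fin 4) (SmoothFun U)) (X : Fin 4 → SmoothFun U) :
    (fun i => eval x (M.mulVec X i)) = (M.map (eval x)).mulVec fun i => eval x (X i) := by
  ext i
  simp [Matrix.mulVec, dotProduct]

/-- In the Jordan frame Z is a multiple of the first basis vector, which is orthogonal to the
others; ⟨Z,Z⟩ = 1 fixes the scale of the rank-one projection. -/
theorem proj_eq_vecMulVec {Z : Fin 4 → SmoothFun U}
    (hZ : H.shape.mulVec Z = algebraMap ℂ (SmoothFun U) (curv α β) • Z)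
    (hZZ : form m 2 U (∑ i, Z i • H.coordVec i) (∑ i, Z i • H.coordVec i) = 1) :
    Polynomial.aeval H.shape (projPoly (curv α β) b) =
      Matrix.vecMulVec Z (fun j => form m 2 U (∑ i, Z i • H.coordVec i) (H.coordVec j)) := by
  refine matrix_ext fun x => ?_
  obtain ⟨Q, ε, hQ, h1, h2⟩ := H.exists_frame_shape x
  set Zx : Fin 4 → ℂ := fun i => eval x (Z i) with hZx
  set g := (gram F x).complexify with hg
  have e1 : (H.shape.map (eval x)).mulVec Zx = curv α β • Zx := by
    rw [hZx, ← map_mulVec, hZ]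
    ext i
    simp [eval_apply]
  have e2 : Zx ⬝ᵥ g.mulVec Zx = 1 := by
    have h := congrArg (eval x) hZZ
    rw [form_comb_comb, map_one] at h
    rw [← h, hg, ← gramFun_eval H, hZx, ← map_mulVec]
    simp [dotProduct]
  set y := Q⁻¹.mulVec Zx with hy
  have hQy : Q.mulVec y = Zx := by
    rw [hy, Matrix.mulVec_mulVec, Matrix.mul_nonsing_inv _ hQ, Matrix.one_mulVec]
  have e3 : (complexJordan (curv α β) b).mulVec y = curv α β • y := by
    have h : Q.mulVec ((complexJordan (curv α β) b).mulVec y) = Q.mulVec (curv α β • y) := by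
      rw [Matrix.mulVec_mulVec, ← h2, ← Matrix.mulVec_mulVec, hQy, e1, Matrix.mulVec_smul, hQy]
    have := congrArg Q⁻¹.mulVec h
    simpa [Matrix.mulVec_mulVec, ← Matrix.mul_assoc, Matrix.nonsing_inv_mul _ hQ] using this
  have e4 := eigenvector_complexJordan H.curv_sub_star_ne_zero H.curv_sub_ne_zero e3
  have e5 : Matrix.vecMul (g.mulVec Zx) Q = (complexMetric ε).mulVec y := by
    rw [← Matrix.mulVec_transpose, ← hQy, Matrix.mulVec_mulVec, Matrix.mulVec_mulVec, h1]
  have e6 : y ⬝ᵥ (complexMetric ε).mulVec y = 1 := by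
    rw [← e5, dotProduct_comm, ← Matrix.dotProduct_mulVec, hQy, dotProduct_comm, e2]
  have e7 : Matrix.vecMulVec y ((complexMetric ε).mulVec y) = firstProj := by
    rw [e4] at e6 ⊢
    simp [complexMetric] at e6
    ext i j
    fin_cases i <;> fin_cases j <;> simp [complexMetric, firstProj, Matrix.vecMulVec_apply]
    linear_combination e6
  have e8 : (Matrix.vecMulVec Z (fun j => form m 2 U (∑ i, Z i • H.coordVec i)
      (H.coordVec j))).map (eval x) = Matrix.vecMulVec Zx (g.mulVec Zx) := by
    rw [hg, ← gramFun_eval H, hZx, ← map_mulVec]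
    ext i j
    rw [Matrix.map_apply, Matrix.vecMulVec_apply, Matrix.vecMulVec_apply, map_mul, form_comb]
  rw [e8, map_aeval_shape]
  refine eq_of_mul_eq_of_isUnit_det hQ ?_
  rw [Matrix.aeval_mul_eq_of_mul_eq h2,
    aeval_projPoly H.curv_sub_star_ne_zero H.curv_sub_ne_zero, Matrix.vecMulVec_mul, e5, ← e7,
    Matrix.mul_vecMulVec, hQy]

/-- At each point the shape operator is similar to the same matrix. The similarity need not be
smooth, since only traces are compared. -/
theorem trace_aeval_shape (p : Polynomial ℂ) : (Polynomial.aeval H.shape p).trace =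
    algebraMap ℂ (SmoothFun U) (Polynomial.aeval (complexJordan (curv α β) b) p).trace := by
  ext x
  obtain ⟨Q, ε, hQ, -, h2⟩ := H.exists_frame_shape x
  rw [SmoothFun.algebraMap_apply,
    ← Matrix.trace_eq_of_mul_eq (Matrix.aeval_mul_eq_of_mul_eq h2 p) hQ, ← map_aeval_shape]
  simp [Matrix.trace, eval_apply]

theorem false_of_unit_eigenvector (x : U) {Z : Fin 4 → SmoothFun U}
    (hZ : H.shape.mulVec Z = algebraMap ℂ (SmoothFun U) (curv α β) • Z)
    (hZZ : form m 2 U (∑ i, Z i • H.coordVec i) (∑ i, Z i • H.coordVec i) = 1) : False := by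
  have hE := H.proj_eq_vecMulVec hZ hZZ
  have he := projPoly_eval H.curv_sub_star_ne_zero H.curv_sub_ne_zero
  have heig : ∀ X : Fin 4 → SmoothFun U, H.shape.mulVec X =
      algebraMap ℂ (SmoothFun U) (curv α β) • X →
      X = form m 2 U (∑ i, X i • H.coordVec i) (∑ i, Z i • H.coordVec i) • Z := by
    intro X hX
    have h := Matrix.aeval_mulVec_of_eigenvector hX (projPoly (curv α β) b)
    rw [he, map_one, one_smul, hE, Matrix.vecMulVec_mulVec] at h
    rw [form_symm, form_comb_comb]
    have h' : (fun j => form m 2 U (∑ i, Z i • H.coordVec i) (H.coordVec j)) =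
        H.gramFun.mulVec Z := funext fun j => H.form_comb Z j
    rw [h', dotProduct_comm] at h
    conv_lhs => rw [← h]
    ext i
    simp [mul_comm]
  -- `projPoly` takes the value 1 at λ; the quotient l, evaluated at A, inverts A - λ off the
  -- eigenline.
  obtain ⟨l, hl⟩ : Polynomial.X - Polynomial.C (curv α β) ∣ 1 - projPoly (curv α β) b := by
    rw [Polynomial.dvd_iff_isRoot, Polynomial.IsRoot, Polynomial.eval_sub, he, Polynomial.eval_one,
      sub_self]
  have hl' : l * (Polynomial.X - Polynomial.C (curv α β)) = 1 - projPoly (curv α β) b := by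
    rw [hl, mul_comm]
  have key := (H.frameEquations Z hZ hZZ heig).trace_eq_zero (projPoly (curv α β) b) l hE hl'
    (fun k i => by
      change dirDeriv (stdVec i) (H.shape ^ k).trace = 0
      have h := H.trace_aeval_shape (Polynomial.X ^ k)
      rw [map_pow, Polynomial.aeval_X] at h
      rw [h, Derivation.map_algebraMap])
  set J := complexJordan (curv α β) b with hJ
  have hM : (Polynomial.aeval J l * (curv α β • J + (κ : ℂ) • 1 -
      ((κ : ℂ) + curv α β * curv α β) • firstProj)).trace = 0 := by
    have key2 : (Polynomial.aeval H.shape l *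
        (algebraMap ℂ (SmoothFun U) (1 * curv α β) • H.shape +
          algebraMap ℂ (SmoothFun U) κ • 1 -
          algebraMap ℂ (SmoothFun U) (κ + 1 * curv α β * curv α β) •
            Polynomial.aeval H.shape (projPoly (curv α β) b))).trace = 0 := key
    -- The trace is that of a polynomial in the shape operator, so it can be computed at J.
    rw [← Matrix.aeval_mul_linear, trace_aeval_shape, Matrix.aeval_mul_linear,
      aeval_projPoly H.curv_sub_star_ne_zero H.curv_sub_ne_zero] at key2
    have key3 := congrArg (eval x) key2
    simpa [eval_apply] using key3
  have hL : Polynomial.aeval J l * (J - algebraMap ℂ _ (curv α β)) = 1 - firstProj := by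
    have h := congrArg (Polynomial.aeval J) hl'
    simpa [aeval_projPoly H.curv_sub_star_ne_zero H.curv_sub_ne_zero, hJ] using h
  exact false_of_cartan H.pos_β H.sq_κ
    (cartan_of_trace_eq_zero H.curv_sub_star_ne_zero H.curv_sub_ne_zero hL hM)

variable (F ξ α β b) in
/-- The square of the eigenvector field which is the projection of the constant vector `w`. -/
def projSq (w : Fin 4 → ℂ) (x : EuclideanSpace ℝ (Fin 4)) : ℂ :=
  (Polynomial.aeval ((gram F x).complexify⁻¹ * (sff F ξ x).complexify)
    (projPoly (curv α β) b)).mulVec w ⬝ᵥ (gram F x).complexify.mulVec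
    ((Polynomial.aeval ((gram F x).complexify⁻¹ * (sff F ξ x).complexify)
      (projPoly (curv α β) b)).mulVec w)

/-- The projection of a constant vector to the eigenspace. -/
def projVec (w : Fin 4 → ℂ) : Fin 4 → SmoothFun U :=
  (Polynomial.aeval H.shape (projPoly (curv α β) b)).mulVec fun i => algebraMap ℂ _ (w i)

theorem shape_mulVec_projVec (w : Fin 4 → ℂ) :
    H.shape.mulVec (H.projVec w) = algebraMap ℂ (SmoothFun U) (curv α β) • H.projVec w := by
  rw [projVec, Matrix.mulVec_mulVec, shape_mul_proj, Matrix.smul_mulVec]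

theorem map_shape (x : U) :
    H.shape.map (eval x) = (gram F x).complexify⁻¹ * (sff F ξ x).complexify := by
  rw [← map_gramFun_mul_map_shape,
    Matrix.nonsing_inv_mul_cancel_left _ _ (H.det_gram_ne_zero x.2).isUnit]

theorem form_projVec_apply (w : Fin 4 → ℂ) (x : U) :
    form m 2 U (∑ i, H.projVec w i • H.coordVec i) (∑ i, H.projVec w i • H.coordVec i) x =
      projSq α β b F ξ w x := by
  have h : (fun i => eval x (H.projVec w i)) =
      (Polynomial.aeval (H.shape.map (eval x)) (projPoly (curv α β) b)).mulVec w := by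
    rw [projVec, map_mulVec, map_aeval_shape]
    congr 1
  have h2 : ∀ X : Fin 4 → SmoothFun U, eval x (X ⬝ᵥ H.gramFun.mulVec X) =
      (fun i => eval x (X i)) ⬝ᵥ (gram F x).complexify.mulVec fun i => eval x (X i) := by
    intro X
    rw [← gramFun_eval H, ← map_mulVec]
    simp [dotProduct]
  rw [form_comb_comb, ← eval_apply, h2, h, projSq, map_shape]

/-- The first column of the Jordan frame at x is fixed by the projection and has square -2. -/
theorem exists_projSq_eq (H : LocalHypersurface κ α β b F ξ U) (x : U) : ∃ w, projSq α β b F ξ w x = -2 := by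
  obtain ⟨Q, ε, hQ, h1, h2⟩ := H.exists_frame_shape x
  refine ⟨Q.mulVec (Pi.single 0 1), ?_⟩
  have h3 : (Pi.single 0 1 : Fin 4 → ℂ) ⬝ᵥ (complexMetric ε).mulVec (Pi.single 0 1) = -2 := by
    simp [complexMetric]
  have h4 : firstProj.mulVec (Pi.single 0 1) = Pi.single 0 1 := by
    ext i
    fin_cases i <;> simp [firstProj]
  rw [projSq, ← map_shape H, Matrix.mulVec_mulVec, Matrix.aeval_mul_eq_of_mul_eq h2,
    aeval_projPoly H.curv_sub_star_ne_zero H.curv_sub_ne_zero, ← Matrix.mulVec_mulVec, h4,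
    ← h3, ← h1, ← Matrix.mulVec_mulVec, ← Matrix.mulVec_mulVec, Matrix.dotProduct_mulVec _ Q.transpose,
    Matrix.vecMul_transpose]

theorem pi_smul_comm {R n : Type*} [CommRing R] (a c : R) (X : n → R) : a • c • X = c • a • X :=
  smul_comm a c X

theorem sum_smul_smul {R W ι : Type*} [CommRing R] [AddCommGroup W] [Module R W] [Fintype ι]
    (c : R) (X : ι → R) (v : ι → W) : ∑ i, (c • X) i • v i = c • ∑ i, X i • v i := by
  simp [Finset.smul_sum, mul_smul]

theorem false_of_mem (H : LocalHypersurface κ α β b F ξ U) {x : EuclideanSpace ℝ (Fin 4)} (hx : x ∈ U) : False := by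
  obtain ⟨w, hw⟩ := H.exists_projSq_eq ⟨x, hx⟩
  have hcont : ContinuousOn (projSq α β b F ξ w) U :=
    (contDiffOn (form m 2 U (∑ i, H.projVec w i • H.coordVec i)
      (∑ i, H.projVec w i • H.coordVec i))).continuousOn.congr fun y hy =>
        (H.form_projVec_apply w ⟨y, hy⟩).symm.trans (zeroExtension_apply _ ⟨y, hy⟩).symm
  -- The square is -2 at x, on the branch cut, so the root is taken of its negative, on the open set
  -- where that lies in the slit plane.
  let U' : Opens (EuclideanSpace ℝ (Fin 4)) :=
    ⟨U ∩ (projSq α β b F ξ w) ⁻¹' {z | -z ∈ Complex.slitPlane},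
      hcont.isOpen_inter_preimage U.isOpen (Complex.isOpen_slitPlane.preimage continuous_neg)⟩
  have hxU' : x ∈ U' := ⟨hx, by simp [hw]⟩
  have H' : LocalHypersurface κ α β b F ξ U' := H.mono fun y hy => hy.1
  set f := form m 2 U' (∑ i, H'.projVec w i • H'.coordVec i)
    (∑ i, H'.projVec w i • H'.coordVec i) with hf
  have hslit : ∀ y, (-f) y ∈ Complex.slitPlane := fun y => by
    rw [SmoothFun.neg_apply, hf, H'.form_projVec_apply]
    exact y.2.2
  obtain ⟨r, hr⟩ := exists_sq_eq (-f) hslit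
  obtain ⟨u, hu⟩ : IsUnit r := isUnit_of_ne_zero r fun y h => by
    refine Complex.slitPlane_ne_zero (hslit y) ?_
    rw [← hr, SmoothFun.mul_apply, h, mul_zero]
  -- With r² = -f, the factor c = i/r satisfies c² = 1/f.
  set c : SmoothFun U' := algebraMap ℂ _ Complex.I * ↑u⁻¹ with hc
  have hI : (algebraMap ℂ (SmoothFun U') Complex.I) * algebraMap ℂ _ Complex.I = -1 := by
    rw [← map_mul, Complex.I_mul_I, map_neg, map_one]
  have hcf : c * c * f = 1 := by
    have h1 : (↑u⁻¹ : SmoothFun U') * r = 1 := by rw [← hu]; exact u.inv_mul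
    rw [hc]
    linear_combination (↑u⁻¹ * ↑u⁻¹ * f) * hI - ↑u⁻¹ * ↑u⁻¹ * hr + (↑u⁻¹ * r + 1) * h1
  refine H'.false_of_unit_eigenvector ⟨x, hxU'⟩ (Z := c • H'.projVec w) ?_ ?_
  · rw [Matrix.mulVec_smul, shape_mulVec_projVec]
    exact pi_smul_comm _ _ _
  · have h := sum_smul_smul c (H'.projVec w) H'.coordVec
    rw [h, map_smul, map_smul, LinearMap.smul_apply, ← hf, ← hcf, smul_eq_mul, smul_eq_mul]
    ring

end LocalHypersurface
end

/-! ### From the hypersurface to a chart -/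

noncomputable section

open TopologicalSpace (Opens)

/-- The pseudo-Euclidean space of index 2 has no negative definite subspace of dimension 3. -/
theorem false_of_negative_orthogonal {m : ℕ} (u : Fin 3 → EuclideanSpace ℝ (Fin m))
    (hneg : ∀ i, pseudoInner m 2 (u i) (u i) < 0)
    (horth : ∀ i j, i ≠ j → pseudoInner m 2 (u i) (u j) = 0) : False := by
  -- The two negative coordinates of a combination of the three vectors (0 when m is too small). A
  -- nonzero kernel element gives a combination with nonnegative square, while orthogonality makes
  -- that square negative.
  let f : (Fin 3 → ℝ) →ₗ[ℝ] (Fin 2 → ℝ) :=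
    (Matrix.of fun (i : Fin 2) (j : Fin 3) => if h : (i : ℕ) < m then u j ⟨i, h⟩ else 0).mulVecLin
  have hker : LinearMap.ker f ≠ ⊥ := LinearMap.ker_ne_bot_of_finrank_lt (by simp)
  obtain ⟨c, hc, hc0⟩ := Submodule.exists_mem_ne_zero_of_ne_bot hker
  have hw : ∀ i : Fin m, (i : ℕ) < 2 → (∑ j, c j • u j) i = 0 := by
    intro i hi
    have h := congrFun (LinearMap.mem_ker.1 hc) ⟨i, hi⟩
    simp only [f, Matrix.mulVecLin_apply, Matrix.mulVec, dotProduct, Matrix.of_apply, i.2,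
      dif_pos, Pi.zero_apply] at h
    rw [← h]
    simp [mul_comm]
  have h1 : 0 ≤ pseudoInner m 2 (∑ j, c j • u j) (∑ j, c j • u j) := by
    rw [pseudoInner_apply]
    refine Finset.sum_nonneg fun i _ => ?_
    split_ifs with hi
    · rw [hw i hi]; simp
    · rw [one_mul]; exact mul_self_nonneg _
  have h2 : pseudoInner m 2 (∑ j, c j • u j) (∑ j, c j • u j) =
      ∑ j, c j ^ 2 * pseudoInner m 2 (u j) (u j) := by
    simp only [map_sum, map_smul, LinearMap.sum_apply, LinearMap.smul_apply, smul_eq_mul]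
    refine Finset.sum_congr rfl fun i _ => ?_
    rw [Finset.sum_eq_single i]
    · ring
    · intro j _ hj
      rw [horth j i hj]; ring
    · simp
  obtain ⟨i, hi⟩ : ∃ i, c i ≠ 0 := by
    by_contra! h
    exact hc0 (funext h)
  have h3 : ∑ j, c j ^ 2 * pseudoInner m 2 (u j) (u j) < 0 := by
    refine Finset.sum_neg' (fun j _ => ?_) ⟨i, Finset.mem_univ i, ?_⟩
    · exact mul_nonpos_of_nonneg_of_nonpos (sq_nonneg _) (hneg j).le
    · exact mul_neg_of_pos_of_neg (by positivity) (hneg i)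
  linarith

theorem petrovMatrix_charpoly_eval (α β b t : ℝ) :
    (petrovMatrix α β b).charpoly.eval t = ((t - α) ^ 2 + β ^ 2) * (t - b) ^ 2 := by
  rw [Matrix.eval_charpoly]
  have : Matrix.scalar (Fin 4) t - petrovMatrix α β b =
      !![t - α, β, 0, 0; -β, t - α, 0, 0; 0, 0, t - b, -1; 0, 0, 0, t - b] := by
    ext i j
    fin_cases i <;> fin_cases j <;> simp [petrovMatrix]
  rw [this]
  simp [Matrix.det_succ_row_zero, Fin.sum_univ_succ, Fin.succAbove]
  ring

/-- b is the only real root. At b ± 1 the factor (t - b)² is 1, and the two values of the quadratic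
factor determine α and β². -/
theorem petrovMatrix_charpoly_injective {α β b α' β' b' : ℝ} (hβ : 0 < β) (hβ' : 0 < β')
    (h : (petrovMatrix α β b).charpoly = (petrovMatrix α' β' b').charpoly) :
    α = α' ∧ β = β' ∧ b = b' := by
  have h1 : ∀ t, ((t - α) ^ 2 + β ^ 2) * (t - b) ^ 2 = ((t - α') ^ 2 + β' ^ 2) * (t - b') ^ 2 := by
    intro t
    rw [← petrovMatrix_charpoly_eval, h, petrovMatrix_charpoly_eval]
  have hb : b = b' := by
    have h2 := (h1 b).symm
    rw [sub_self, zero_pow two_ne_zero, mul_zero] at h2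
    have h3 : (b - α') ^ 2 + β' ^ 2 ≠ 0 := by positivity
    exact sub_eq_zero.1 (pow_eq_zero_iff two_ne_zero |>.1 ((mul_eq_zero.1 h2).resolve_left h3))
  subst hb
  have e1 := h1 (b + 1)
  have e2 := h1 (b - 1)
  simp only [add_sub_cancel_left, sub_sub_cancel_left, one_pow, even_two, Even.neg_pow, mul_one] at e1 e2
  have hα : α = α' := by linear_combination (e2 - e1) / 4
  subst hα
  refine ⟨rfl, ?_, rfl⟩
  have : β ^ 2 = β' ^ 2 := by linear_combination e1
  exact (pow_left_inj₀ hβ.le hβ'.le two_ne_zero).1 this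

theorem eq_of_aroots_eq {p q : Polynomial ℝ} (hp : p.Monic) (hq : q.Monic)
    (h : p.aroots ℂ = q.aroots ℂ) : p = q := by
  refine Polynomial.map_injective (algebraMap ℝ ℂ) (algebraMap ℝ ℂ).injective ?_
  rw [Polynomial.Splits.eq_prod_roots_of_monic (IsAlgClosed.splits (p.map _)) (hp.map _),
    Polynomial.Splits.eq_prod_roots_of_monic (IsAlgClosed.splits (q.map _)) (hq.map _)]
  exact congrArg (fun s : Multiset ℂ => (s.map fun a => Polynomial.X - Polynomial.C a).prod) h

theorem SpaceForm.curvature_mul_self {d : ℕ} (N : SpaceForm d) :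
    N.curvature * N.curvature = N.curvature := by
  cases N <;> simp [SpaceForm.curvature]

theorem SpaceForm.mem_carrier_iff {d : ℕ} (N : SpaceForm d) (p : N.Vec) :
    p ∈ N.carrier ↔ N.curvature * N.form p p = N.curvature := by
  cases N <;> simp [SpaceForm.curvature, SpaceForm.carrier]

theorem SpaceForm.mem_tangent_iff {d : ℕ} (N : SpaceForm d) (p v : N.Vec) :
    v ∈ N.tangent p ↔ N.curvature * N.form p v = 0 := by
  cases N <;> simp [SpaceForm.curvature, SpaceForm.tangent]

theorem SpaceForm.form_symm {d : ℕ} (N : SpaceForm d) (u v : N.Vec) : N.form u v = N.form v u :=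
  pseudoInner_symm _ _ u v

namespace Hypersurface

section General

variable {n : ℕ} {N : SpaceForm (n + 1)} {M : Type*} [TopologicalSpace M]
  [ChartedSpace (EuclideanSpace ℝ (Fin n)) M] (H : Hypersurface N M)

theorem mem_range_differential_of_mem (x : M) {u : N.Vec} (h1 : u ∈ N.tangent (H.toFun x))
    (h2 : N.form (H.normal x) u = 0) : u ∈ LinearMap.range (H.differential x) := by
  have hinj : Function.Injective (H.differential x) := H.injective_mfderiv x
  have hle : LinearMap.range (H.differential x) ≤
      N.tangent (H.toFun x) ⊓ LinearMap.ker (N.form (H.normal x)) := by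
    rintro _ ⟨w, rfl⟩
    exact ⟨H.differential_apply_mem_tangent x w, LinearMap.mem_ker.2
      ((pseudoInner_symm _ _ _ _).trans (H.normal_orthogonal x w))⟩
  have heq := Submodule.eq_of_le_of_finrank_le hle (by
    rw [LinearMap.finrank_range_of_inj hinj]
    exact (H.finrank_le x).trans_eq (finrank_euclideanSpace_fin (𝕜 := ℝ) (n := n)).symm)
  rw [heq]
  exact ⟨h1, LinearMap.mem_ker.2 h2⟩

theorem eq_zero_of_orthogonal (x : M) {u : N.Vec} (h1 : N.curvature * N.form u (H.toFun x) = 0)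
    (h2 : N.form u (H.normal x) = 0) (h3 : ∀ w, N.form u (H.differential x w) = 0) : u = 0 := by
  obtain ⟨v, rfl⟩ := H.mem_range_differential_of_mem x (u := u)
    ((N.mem_tangent_iff _ _).2 (by rw [N.form_symm]; exact h1)) (by rw [N.form_symm]; exact h2)
  rw [H.nondegenerate x v h3, map_zero]

/-- For κ ≠ 0 this is polarization: F, ξ and F + ξ all have constant square, so each is orthogonal
to its differential. Hence projecting dξ to the tangent space of the space form changes nothing. -/
theorem curvature_mul_form_normalDifferential (x : M) (v : TangentSpace (𝓡 n) x) :
    N.curvature * N.form (H.toFun x) (H.normalDifferential x v) = 0 := by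
  by_cases hκ : N.curvature = 0
  · rw [hκ, zero_mul]
  have hadd : ∀ u v u' v' : N.Vec, N.form (u + v) (u' + v') =
      N.form u u' + N.form u v' + (N.form v u' + N.form v v') := fun u v u' v' => by
    rw [LinearMap.map_add₂, map_add, map_add]
  have hF := H.contMDiff_toFun.mdifferentiable (by simp) x
  have hξ := H.contMDiff_normal.mdifferentiable (by simp) x
  have hFF : ∀ y, N.form (H.toFun y) (H.toFun y) = 1 := fun y =>
    mul_left_cancel₀ hκ (((N.mem_carrier_iff _).1 (H.mem_carrier y)).trans (mul_one _).symm)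
  have hFξ : ∀ y, N.form (H.toFun y) (H.normal y) = 0 := fun y =>
    (mul_eq_zero.1 ((N.mem_tangent_iff _ _).1 (H.normal_mem_tangent y))).resolve_left hκ
  have h1 : N.form (H.toFun x) (H.differential x v) = 0 :=
    form_mfderiv_eq_zero (pseudoInner_symm _ _) hF hFF v
  have h2 : N.form (H.normal x) (H.normalDifferential x v) = 0 :=
    form_mfderiv_eq_zero (pseudoInner_symm _ _) hξ (fun y => H.normal_normal y) v
  have h3 := form_mfderiv_eq_zero (I := 𝓡 n) (f := H.toFun + H.normal) (B := N.form) (x := x)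
    (pseudoInner_symm _ _) (hF.add hξ) (c := 1 + H.sign) (fun y => by
      rw [Pi.add_apply, hadd, hFF, H.normal_normal, hFξ, N.form_symm (H.normal y), hFξ]
      ring) v
  rw [mfderiv_add hF hξ] at h3
  have h4 : N.form (H.toFun x + H.normal x)
    (H.differential x v + H.normalDifferential x v) = 0 := h3
  have h5 : N.form (H.normal x) (H.differential x v) = 0 :=
    (N.form_symm _ _).trans (H.normal_orthogonal x v)
  rw [hadd, h1, h2, h5] at h4
  have h6 : N.form (H.toFun x) (H.normalDifferential x v) = 0 := by linarith
  rw [h6, mul_zero]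

theorem normalDifferential_eq (x : M) (v : TangentSpace (𝓡 n) x) :
    H.normalDifferential x v = -H.differential x (H.shapeOperator x v) := by
  rw [H.differential_shapeOperator, neg_neg]
  have h := H.curvature_mul_form_normalDifferential x v
  have h2 : H.covDerivNormal x v = H.normalDifferential x v -
      (N.curvature * N.form (H.toFun x) (H.normalDifferential x v)) • H.toFun x := by
    simp [covDerivNormal, SpaceForm.tangentProj, smul_smul]
  rw [h2, h, zero_smul, sub_zero]

end General

section PetrovTypeIV

variable {N : SpaceForm 5} {M : Type*} [TopologicalSpace M]
  [ChartedSpace (EuclideanSpace ℝ (Fin 4)) M] (H : Hypersurface N M)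

/-- Otherwise e₀, e₂ - εe₃ (of square -2ε² = -2) and ξ would be three orthogonal vectors of negative
square in index 2. -/
theorem sign_eq_one (hN : N.index = 2) (hH : H.HasPetrovTypeIV) (x : M) : H.sign = 1 := by
  refine H.sign_eq.resolve_right fun hs => ?_
  obtain ⟨e, α, β, b, ε, -, hε, -, hg⟩ := hH x
  have hg' : ∀ i j, N.form (H.differential x (e i)) (H.differential x (e j)) =
      petrovMetric ε i j := fun i j => by
    have h := congrFun (congrFun hg i) j
    rw [LinearMap.BilinForm.toMatrix_apply] at h
    exact h
  have hform : N.form = pseudoInner N.vecDim 2 := by rw [SpaceForm.form, hN]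
  have hξ : ∀ v, N.form (H.differential x v) (H.normal x) = 0 := H.normal_orthogonal x
  have hεε : ε * ε = 1 := by rcases hε with rfl | rfl <;> norm_num
  have g1 : N.form (H.differential x (e 2 - ε • e 3)) (H.differential x (e 2 - ε • e 3)) = -2 := by
    simp only [map_sub, map_smul, LinearMap.sub_apply, LinearMap.smul_apply, hg', smul_eq_mul]
    simp [petrovMetric]
    linarith
  have g2 : N.form (H.differential x (e 0)) (H.differential x (e 2 - ε • e 3)) = 0 := by
    simp only [map_sub, map_smul, hg', smul_eq_mul]
    simp [petrovMetric]
  have g3 : N.form (H.differential x (e 0)) (H.differential x (e 0)) = -1 := by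
    rw [hg']; simp [petrovMetric]
  refine false_of_negative_orthogonal (m := N.vecDim)
    ![H.differential x (e 0), H.differential x (e 2 - ε • e 3), H.normal x] ?_ ?_
  · rw [← hform]
    intro i
    fin_cases i
    · simp [g3]
    · change N.form (H.differential x (e 2 - ε • e 3)) (H.differential x (e 2 - ε • e 3)) < 0
      rw [g1]; norm_num
    · simp [H.normal_normal, hs]
  · rw [← hform]
    have hsymm : ∀ u v : N.Vec, N.form u v = 0 → N.form v u = 0 := fun u v h => by
      rw [N.form_symm, h]
    intro i j hij
    fin_cases i <;> fin_cases j
    · exact absurd rfl hij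
    · exact g2
    · exact hξ _
    · exact hsymm _ _ g2
    · exact absurd rfl hij
    · exact hξ _
    · exact hsymm _ _ (hξ _)
    · exact hsymm _ _ (hξ _)
    · exact absurd rfl hij

theorem charpoly_eq_of_petrov {x : M} {e : Module.Basis (Fin 4) ℝ (TangentSpace (𝓡 4) x)}
    {α β b : ℝ} (h : LinearMap.toMatrix e e (H.shapeOperator x) = petrovMatrix α β b) :
    (H.shapeOperator x).charpoly = (petrovMatrix α β b).charpoly := by
  rw [← h, LinearMap.charpoly_toMatrix]

/-- The frames of the definition of Petrov type IV, with constant principal curvatures. -/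
theorem exists_petrov_frames [Nonempty M] (hiso : H.IsIsoparametric) (hH : H.HasPetrovTypeIV) :
    ∃ α β b : ℝ, 0 < β ∧ ∀ x : M, ∃ (e : Fin 4 → TangentSpace (𝓡 4) x) (ε : ℝ),
      (ε = 1 ∨ ε = -1) ∧
      (∀ j, H.shapeOperator x (e j) = ∑ i, petrovMatrix α β b i j • e i) ∧
      ∀ i j, N.form (H.differential x (e i)) (H.differential x (e j)) = petrovMetric ε i j := by
  obtain ⟨x₀⟩ := ‹Nonempty M›
  obtain ⟨e₀, α, β, b, ε₀, hβ, -, hA₀, -⟩ := hH x₀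
  refine ⟨α, β, b, hβ, fun x => ?_⟩
  obtain ⟨e, α', β', b', ε, hβ', hε, hA, hg⟩ := hH x
  -- Isoparametricity makes the parameters found at x₀ valid at every point; the sign ε and the
  -- frame may still vary arbitrarily with x.
  have h1 : (petrovMatrix α β b).charpoly = (petrovMatrix α' β' b').charpoly := by
    rw [← H.charpoly_eq_of_petrov hA₀, ← H.charpoly_eq_of_petrov hA]
    exact eq_of_aroots_eq (LinearMap.charpoly_monic _) (LinearMap.charpoly_monic _) (hiso x₀ x)
  obtain ⟨rfl, rfl, rfl⟩ := petrovMatrix_charpoly_injective hβ hβ' h1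
  refine ⟨e, ε, hε, fun j => ?_, fun i j => ?_⟩
  · rw [← e.sum_repr (H.shapeOperator x (e j))]
    refine Finset.sum_congr rfl fun i _ => ?_
    rw [← LinearMap.toMatrix_apply, hA]
    rfl
  · have h := congrFun (congrFun hg i) j
    rw [LinearMap.BilinForm.toMatrix_apply] at h
    exact h

variable [IsManifold (𝓡 4) ∞ M]

theorem fderiv_comp_chart_symm {V : Type*} [NormedAddCommGroup V] [NormedSpace ℝ V] {f : M → V}
    (hf : ContMDiff (𝓡 4) 𝓘(ℝ, V) ∞ f) (x₀ : M) {y : EuclideanSpace ℝ (Fin 4)}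
    (hy : y ∈ (chartAt (EuclideanSpace ℝ (Fin 4)) x₀).target) (v : EuclideanSpace ℝ (Fin 4)) :
    fderiv ℝ (f ∘ (chartAt (EuclideanSpace ℝ (Fin 4)) x₀).symm) y v =
      mfderiv (𝓡 4) 𝓘(ℝ, V) f ((chartAt (EuclideanSpace ℝ (Fin 4)) x₀).symm y)
        (mfderiv (𝓡 4) (𝓡 4) (chartAt (EuclideanSpace ℝ (Fin 4)) x₀).symm y v) := by
  have : IsManifold (𝓡 4) 1 M := IsManifold.of_le (n := ∞) (by simp)
  rw [← mfderiv_eq_fderiv, mfderiv_comp y (hf.mdifferentiable (by simp) _)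
    ((mdifferentiable_chart x₀).mdifferentiableAt_symm hy)]
  rfl

theorem contDiffOn_comp_chart_symm {V : Type*} [NormedAddCommGroup V] [NormedSpace ℝ V] {f : M → V}
    (hf : ContMDiff (𝓡 4) 𝓘(ℝ, V) ∞ f) (x₀ : M) :
    ContDiffOn ℝ ∞ (f ∘ (chartAt (EuclideanSpace ℝ (Fin 4)) x₀).symm)
      (chartAt (EuclideanSpace ℝ (Fin 4)) x₀).target :=
  contMDiffOn_iff_contDiffOn.1 (hf.comp_contMDiffOn contMDiffOn_chart_symm)

theorem not_isoparametric_of_petrovTypeIV [Nonempty M] (hN : N.index = 2)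
    (hiso : H.IsIsoparametric) (hH : H.HasPetrovTypeIV) : False := by
  obtain ⟨α, β, b, hβ, hframe⟩ := H.exists_petrov_frames hiso hH
  obtain ⟨x₀⟩ := ‹Nonempty M›
  have : IsManifold (𝓡 4) 1 M := IsManifold.of_le (n := ∞) (by simp)
  set c := chartAt (EuclideanSpace ℝ (Fin 4)) x₀ with hc
  have hform : pseudoInner N.vecDim 2 = N.form := by rw [SpaceForm.form, hN]
  let ψ (y : EuclideanSpace ℝ (Fin 4)) :
      EuclideanSpace ℝ (Fin 4) →L[ℝ] TangentSpace (𝓡 4) (c.symm y) :=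
    mfderiv (𝓡 4) (𝓡 4) c.symm y
  have hψ : ∀ y ∈ c.target, Function.Surjective (ψ y) := fun y hy =>
    (mdifferentiable_chart x₀).symm.mfderiv_surjective hy
  have hF : ∀ y ∈ c.target, ∀ v, fderiv ℝ (H.toFun ∘ c.symm) y v =
      H.differential (c.symm y) (ψ y v) :=
    fun y hy v => fderiv_comp_chart_symm H.contMDiff_toFun x₀ hy v
  have hξ : ∀ y ∈ c.target, ∀ v, fderiv ℝ (H.normal ∘ c.symm) y v =
      H.normalDifferential (c.symm y) (ψ y v) :=
    fun y hy v => fderiv_comp_chart_symm H.contMDiff_normal x₀ hy v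
  -- The contradiction is local, so a single chart suffices.
  have hloc : LocalHypersurface (m := N.vecDim) N.curvature α β b (H.toFun ∘ c.symm)
      (H.normal ∘ c.symm) ⟨c.target, c.open_target⟩ := by
    refine ⟨hβ, N.curvature_mul_self, contDiffOn_comp_chart_symm H.contMDiff_toFun x₀,
      contDiffOn_comp_chart_symm H.contMDiff_normal x₀, ?_, ?_, ?_, ?_, ?_, ?_⟩ <;>
      intro y hy <;> rw [hform]
    · exact (H.normal_normal _).trans (H.sign_eq_one hN hH x₀)
    · exact (N.mem_carrier_iff _).1 (H.mem_carrier _)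
    · exact (N.mem_tangent_iff _ _).1 (H.normal_mem_tangent _)
    · intro v
      rw [hF y hy]
      exact H.normal_orthogonal _ _
    · intro u h1 h2 h3
      refine H.eq_zero_of_orthogonal (c.symm y) h3 h2 fun w => ?_
      obtain ⟨v, rfl⟩ := hψ y hy w
      rw [← hF y hy]
      exact h1 v
    · obtain ⟨e, ε, hε, h1, h2⟩ := hframe (c.symm y)
      choose f hf using fun j => hψ y hy (e j)
      refine ⟨f, ε, hε, fun j => ?_, fun i j => ?_⟩
      · rw [hξ y hy, hf, H.normalDifferential_eq, h1, map_sum]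
        congr 1
        refine Finset.sum_congr rfl fun i _ => ?_
        rw [map_smul, hF y hy, hf]
      · rw [hF y hy, hF y hy, hf, hf]
        exact h2 i j
  exact hloc.false_of_mem (x := c x₀) (mem_chart_target _ x₀)

end PetrovTypeIV

end Hypersurface
end

theorem theorem4p20 {M : Type*} [TopologicalSpace M] [T2Space M] [SecondCountableTopology M]
    [ConnectedSpace M] [ChartedSpace (EuclideanSpace ℝ (Fin 4)) M] [IsManifold (𝓡 4) ∞ M] :
    (¬ ∃ H : Hypersurface (SpaceForm.pseudoEuclidean 2 : SpaceForm 5) M,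
      H.IsIsoparametric ∧ H.HasPetrovTypeIV) ∧
    (¬ ∃ H : Hypersurface (SpaceForm.pseudoSphere 2 : SpaceForm 5) M,
      H.IsIsoparametric ∧ H.HasPetrovTypeIV) :=
  ⟨fun ⟨H, h1, h2⟩ => H.not_isoparametric_of_petrovTypeIV rfl h1 h2,
    fun ⟨H, h1, h2⟩ => H.not_isoparametric_of_petrovTypeIV rfl h1 h2⟩
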